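/- **Conventions.** $\mathrm{Homeo}_+(\mathbb R)$ and $\mathrm{Homeo}_+(\mathbb S^1)$ are the groups of orientation preserving homeomorphisms. A subgroup $G\le \mathrm{Homeo}_+(\mathbb S^1)$ is *topologically transitive* if for all nonempty open $U,V\subseteq\mathbb S^1$ there is $g\in G$ with $g(U)\cap V\ne\emptyset$; it is *tightly transitive* if it is topologically transitive and no subgroup $F\le G$ with $[G:F]=\infty$ is topologically transitive; it is *almost minimal* if at most countably many points of $\mathbb S^1$ have a non-dense $G$-orbit. Two subgroups $G,H$ are *topologically conjugate* if $\psi G\psi^{-1}=H$ for some $\psi\in\mathrm{Homeo}_+(\mathbb S^1)$. **The line groups $G_{\alpha,n}$.** Let $L_a(x)=x+a$, and fix any homeomorphism $\hbar:\mathbb R\to(0,1)$. For $\sigma\in \mathrm{Homeo}_+(\mathbb R)$ let $\hbar(\sigma)\in\mathrm{Homeo}_+(\mathbb R)$ be given by $\hbar(\sigma)(x)=\hbar\sigma\hbar^{-1}(x-i)+i$ for $x\in(i,i+1)$, $i\in\mathbb Z$, and $\hbar(\sigma)(x)=x$ for $x\in\mathbb Z$. For $\alpha\in(0,1)$ irrational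 put $G_{\alpha,2}=\langle L_1,L_\alpha\rangle$ and, for $n\ge 2$, $G_{\alpha,n+1}=\langle \{\hbar(\sigma):\sigma\in G_{\alpha,n}\}\cup\{L_1\}\rangle$. **The circle groups $G_{\alpha,n,k,g,f}$.** For an integer $k\ge1$ put $x_j=e^{2\pi \mathbf i j/k}$ (so $x_{k+1}=x_1$), let $(x_j,x_{j+1})$ be the open arc from $x_j$ to $x_{j+1}$ anticlockwise (for $k=1$ it is $\mathbb S^1\setminus\{1\}$), and fix any orientation preserving homeomorphism $\phi=\phi_k:\mathbb R\to(x_1,x_2)$. Let $n\ge2$, $\alpha\in(0,1)$ irrational, and let $g\in G_{\alpha,n}$ be such that $g\neq w^s$ for every $w\in G_{\alpha,n}$ and every integer $s\ge1$ with $\gcd(k,s)\ne1$. Let $f\in\mathrm{Homeo}_+(\mathbb S^1)$ satisfy $f(x_j)=x_{j+1}$ for $1\le j\le k$ and $f^k|_{(x_1,x_2)}=\phi g\phi^{-1}$. For $\sigma\in\mathrm{Homeo}_+(\mathbb R)$ let $\overline\sigma\in\mathrm{Homeo}_+(\mathbb S^1)$ fix $x_1,\dots,x_k$ and be equal to $f^{j-1}\phi\sigma\phi^{-1}f^{-(j-1)}$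 on $(x_j,x_{j+1})$, $1\le j\le k$. Then $G_{\alpha,n,k,g,f}$ is the subgroup of $\mathrm{Homeo}_+(\mathbb S^1)$ generated by $\{\overline\sigma:\sigma\in G_{\alpha,n}\}\cup\{f\}$. **Theorem 5.3.** Let $n\ge2$ and let $G$ be a tightly transitive and almost minimal subgroup of $\mathrm{Homeo}_+(\mathbb S^1)$ that is isomorphic to $\mathbb Z^n$. Then, for whatever choice of $\hbar$ and of $\phi_k$ ($k\ge1$), $G$ is topologically conjugate to some $G_{\alpha,n,k,g,f}$, that is, there are an irrational $\alpha\in(0,1)$, an integer $k\ge1$, and $g$ and $f$ as above (with the same $n$) such that $G$ is topologically conjugate to $G_{\alpha,n,k,g,f}$. -/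

import Mathlib

namespace TightCircle

/-! ### Homeomorphisms of the line and of the circle -/

/-- The group of orientation preserving homeomorphisms of `ℝ`. These are exactly the
order automorphisms of `ℝ` (an increasing bijection of `ℝ` is a homeomorphism); the
product is composition. -/
abbrev HomeoPlusLine : Type := ℝ ≃o ℝ

/-- The subgroup of the homeomorphism group of the circle made of the orientation preserving
homeomorphisms: those that lift to an increasing homeomorphism of `ℝ` through the universal
covering `t ↦ exp (i t)`. -/
noncomputable def homeoPlusCircle : Subgroup (Circle ≃ₜ Circle) where
  carrier := {f | ∃ F : ℝ ≃o ℝ, ∀ t : ℝ, f (Circle.exp t) = Circle.exp (F t)}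
  mul_mem' := by
    rintro f g ⟨F, hF⟩ ⟨G, hG⟩
    exact ⟨G.trans F, fun t => by simp [hF, hG]⟩
  one_mem' := ⟨OrderIso.refl ℝ, fun t => rfl⟩
  inv_mem' := by
    rintro f ⟨F, hF⟩
    refine ⟨F.symm, fun t => ?_⟩
    rw [Homeomorph.inv_apply, Homeomorph.symm_apply_eq, hF, OrderIso.apply_symm_apply]

/-- The group of orientation preserving homeomorphisms of the circle. -/
abbrev HomeoPlusCircle : Type := ↥homeoPlusCircle

/-- The tautological action of homeomorphisms of the circle on the circle: `f • x = f x`. -/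
noncomputable instance : MulAction (Circle ≃ₜ Circle) Circle where
  smul f x := f x
  one_smul _ := rfl
  mul_smul _ _ _ := rfl

/-! ### Dynamical notions -/

/-- `G` is tightly transitive: it is topologically transitive and no subgroup of `G` of infinite
index in `G` is (`Subgroup.relIndex` is `0` exactly when the index is infinite). -/
def IsTightlyTransitive (G : Subgroup HomeoPlusCircle) : Prop :=
  MulAction.IsTopologicallyTransitive G Circle ∧
    ∀ F : Subgroup HomeoPlusCircle, F ≤ G → F.relIndex G = 0 →
      ¬ MulAction.IsTopologicallyTransitive F Circle

/-- `G` is almost minimal: at most countably many points have a non-dense `G`-orbit. -/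
def IsAlmostMinimal (G : Subgroup HomeoPlusCircle) : Prop :=
  {x : Circle | ¬ Dense (MulAction.orbit G x)}.Countable

/-- `G` and `H` are conjugate by an orientation preserving homeomorphism of the circle. -/
def AreTopConjugate (G H : Subgroup HomeoPlusCircle) : Prop :=
  ∃ ψ : HomeoPlusCircle, G.map (MulAut.conj ψ).toMonoidHom = H

/-! ### Gluing homeomorphisms along a grid -/

/-- Every real number lies on the grid `c ℤ` or in one of its complementary intervals. -/
theorem grid_cases {c : ℝ} (hc : 0 < c) (x : ℝ) :
    (∃ j : ℤ, x = c * j) ∨ ∃ j : ℤ, x ∈ Set.Ioo (c * j) (c * (j + 1)) := by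
  have h1 : (⌊x / c⌋ : ℝ) ≤ x / c := Int.floor_le _
  have h2 : x / c < ⌊x / c⌋ + 1 := Int.lt_floor_add_one _
  rw [le_div_iff₀ hc] at h1
  rw [div_lt_iff₀ hc] at h2
  rcases eq_or_lt_of_le h1 with h | h
  · exact Or.inl ⟨⌊x / c⌋, by linarith⟩
  · exact Or.inr ⟨⌊x / c⌋, by linarith, by linarith⟩

/-- If every complementary interval of the grid `c ℤ` is parametrized by `ℝ` through a monotone
map, homeomorphisms of `ℝ` are transported to these intervals and glued to one of `ℝ` that fixes
the grid. -/
theorem exists_glue {c : ℝ} (hc : 0 < c) (P : ℤ → ℝ → ℝ)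
    (hP : ∀ j, StrictMono (P j) ∨ StrictAnti (P j))
    (hr : ∀ j : ℤ, Set.range (P j) = Set.Ioo (c * j) (c * (j + 1))) (σ : ℝ ≃o ℝ) :
    ∃ S : ℝ ≃o ℝ, (∀ j : ℤ, S (c * j) = c * j) ∧ ∀ j t, S (P j t) = P j (σ t) := by
  classical
  have hmem : ∀ (j : ℤ) (t : ℝ), P j t ∈ Set.Ioo (c * j) (c * ((j : ℝ) + 1)) := fun j t => by
    rw [← hr]; exact ⟨t, rfl⟩
  have hlt : ∀ j l : ℤ, ∀ x y : ℝ, c * j ≤ x → y < c * (l + 1) → x ≤ y → j ≤ l := by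
    intro j l x y h1 h2 h3
    have h : c * (j : ℝ) < c * ((l : ℝ) + 1) := by linarith
    have h' : (j : ℝ) < (l : ℝ) + 1 := lt_of_mul_lt_mul_left h hc.le
    exact Int.lt_add_one_iff.1 (by exact_mod_cast h')
  have hinj : ∀ j, Function.Injective (P j) := fun j =>
    (hP j).elim StrictMono.injective StrictAnti.injective
  -- the glued map
  have key : ∀ τ : ℝ ≃o ℝ, ∃ S : ℝ → ℝ,
      (∀ j : ℤ, S (c * j) = c * j) ∧ ∀ j t, S (P j t) = P j (τ t) := by
    intro τ
    refine ⟨fun x => if h : ∃ p : ℤ × ℝ, P p.1 p.2 = x then P h.choose.1 (τ h.choose.2) else x,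
      ?_, ?_⟩
    · intro j
      refine dif_neg ?_
      rintro ⟨⟨l, t⟩, h⟩
      have h1 := hmem l t
      simp only at h
      rw [h] at h1
      have a := lt_of_mul_lt_mul_left h1.1 hc.le
      have b := lt_of_mul_lt_mul_left h1.2 hc.le
      have a' : l < j := by exact_mod_cast a
      have b' : j < l + 1 := by exact_mod_cast b
      omega
    · intro j t
      have h : ∃ p : ℤ × ℝ, P p.1 p.2 = P j t := ⟨(j, t), rfl⟩
      have e := h.choose_spec
      have h1 := hmem h.choose.1 h.choose.2
      have h2 := hmem j t
      have e1 : h.choose.1 = j := le_antisymm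
        (hlt _ _ _ _ h1.1.le h2.2 e.le) (hlt _ _ _ _ h2.1.le h1.2 e.ge)
      have e2 : h.choose.2 = t := by
        apply hinj j
        exact (congrArg (fun l => P l h.choose.2) e1.symm).trans e
      simp only [dif_pos h]
      rw [e1, e2]
  obtain ⟨S, hS1, hS2⟩ := key σ
  obtain ⟨T, hT1, hT2⟩ := key σ.symm
  have cases : ∀ x : ℝ, (∃ j : ℤ, x = c * j) ∨ ∃ j t, x = P j t := by
    intro x
    rcases grid_cases hc x with h | ⟨j, h⟩
    · exact Or.inl h
    · rw [← hr] at h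
      obtain ⟨t, ht⟩ := h
      exact Or.inr ⟨j, t, ht.symm⟩
  have hmono : StrictMono S := by
    intro x y hxy
    rcases cases x with ⟨j, rfl⟩ | ⟨j, t, rfl⟩ <;> rcases cases y with ⟨l, rfl⟩ | ⟨l, s, rfl⟩
    · rwa [hS1, hS1]
    · rw [hS1, hS2]
      have h := hlt j l _ _ le_rfl (hmem l s).2 hxy.le
      have h' : (j : ℝ) ≤ l := by exact_mod_cast h
      exact lt_of_le_of_lt (mul_le_mul_of_nonneg_left h' hc.le) (hmem l (σ s)).1
    · rw [hS1, hS2]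
      have h : (j : ℝ) < l := lt_of_mul_lt_mul_left ((hmem j t).1.trans hxy) hc.le
      have h' : (j : ℝ) + 1 ≤ l := by
        have : j < l := by exact_mod_cast h
        exact_mod_cast this
      exact lt_of_lt_of_le (hmem j (σ t)).2 (mul_le_mul_of_nonneg_left h' hc.le)
    · rw [hS2, hS2]
      have h := hlt j l _ _ (hmem j t).1.le (hmem l s).2 hxy.le
      rcases eq_or_lt_of_le h with rfl | h
      · rcases hP j with m | m
        · exact m (σ.strictMono (m.lt_iff_lt.1 hxy))
        · exact m (σ.strictMono (m.lt_iff_gt.1 hxy))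
      · have h' : (j : ℝ) + 1 ≤ l := by exact_mod_cast h
        have := mul_le_mul_of_nonneg_left h' hc.le
        exact (hmem j (σ t)).2.trans (lt_of_le_of_lt this (hmem l (σ s)).1)
  have hright : Function.RightInverse T S := by
    intro x
    rcases cases x with ⟨j, rfl⟩ | ⟨j, t, rfl⟩
    · rw [hT1, hS1]
    · rw [hT2, hS2, OrderIso.apply_symm_apply]
  exact ⟨hmono.orderIsoOfRightInverse S T hright, hS1, hS2⟩

/-! ### The groups `G_{α,n}` on the line -/

/-- For a homeomorphism `h : ℝ → (0,1)` and `σ`, there is exactly one orientation preserving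
homeomorphism of `ℝ` that fixes each integer `i` and equals
`x ↦ h (σ (h⁻¹ (x - i))) + i` on `(i, i + 1)`. -/
theorem existsUnique_hbar (h : ℝ ≃ₜ Set.Ioo (0 : ℝ) 1) (σ : HomeoPlusLine) :
    ∃! S : HomeoPlusLine, (∀ i : ℤ, S i = i) ∧
      ∀ (i : ℤ) (x : ℝ), S ((h x : ℝ) + i) = (h (σ x) : ℝ) + i := by
  have hm : StrictMono (fun t => (h t : ℝ)) ∨ StrictAnti (fun t => (h t : ℝ)) :=
    Continuous.strictMono_of_inj (continuous_subtype_val.comp h.continuous)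
      (Subtype.val_injective.comp h.injective)
  have hr : ∀ j : ℤ, Set.range (fun t => (h t : ℝ) + j) =
      Set.Ioo ((1 : ℝ) * j) (1 * (j + 1)) := by
    intro j
    ext x
    constructor
    · rintro ⟨t, rfl⟩
      have := (h t).2
      exact ⟨by simpa using this.1, by have := this.2; simp only; linarith⟩
    · intro hx
      refine ⟨h.symm ⟨x - j, ?_, ?_⟩, ?_⟩
      · linarith [hx.1]
      · linarith [hx.2]
      · simp
  obtain ⟨S, h1, h2⟩ := exists_glue one_pos (fun j t => (h t : ℝ) + j)
    (fun j => hm.imp (fun m _ _ hab => by simpa using m hab)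
      (fun m _ _ hab => by simpa using m hab)) hr σ
  refine ⟨S, ⟨fun i => by simpa using h1 i, fun i x => h2 i x⟩, ?_⟩
  rintro T ⟨hT1, hT2⟩
  ext x
  rcases grid_cases one_pos x with ⟨j, rfl⟩ | ⟨j, hx⟩
  · rw [h1, one_mul, hT1]
  · rw [← hr] at hx
    obtain ⟨t, rfl⟩ := hx
    rw [h2]
    exact hT2 j t

/-- The homeomorphism `ħ(σ)` of `ℝ`: `ħ(σ)(x) = h (σ (h⁻¹ (x - i))) + i` for `x ∈ (i, i + 1)`,
`i ∈ ℤ`, and `ħ(σ)(x) = x` for `x ∈ ℤ`. -/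
noncomputable def hbar (h : ℝ ≃ₜ Set.Ioo (0 : ℝ) 1) (σ : HomeoPlusLine) : HomeoPlusLine :=
  (existsUnique_hbar h σ).choose

/-- The translation `L_a : x ↦ x + a`. -/
def translation (a : ℝ) : HomeoPlusLine := OrderIso.addRight a

/-- The groups `G_{α,n}`, `n ≥ 2`, of homeomorphisms of the line: `G_{α,2} = ⟨L_1, L_α⟩` and
`G_{α,n+1} = ⟨ħ(G_{α,n}), L_1⟩`. The values at `n = 0, 1` are placeholders without meaning. -/
noncomputable def lineGroup (h : ℝ ≃ₜ Set.Ioo (0 : ℝ) 1) (α : ℝ) : ℕ → Subgroup HomeoPlusLine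
  | 0 => ⊥
  | 1 => ⊥
  | 2 => Subgroup.closure {translation 1, translation α}
  | n + 3 => Subgroup.closure
      (hbar h '' (lineGroup h α (n + 2) : Set HomeoPlusLine) ∪ {translation 1})

/-! ### The groups `G_{α,n,k,g,f}` on the circle -/

/-- The point `x_j = exp (2 π i j / k)` of the circle. -/
noncomputable def rootPoint (k j : ℕ) : Circle := Circle.exp (2 * Real.pi * j / k)

/-- `φ` is an orientation preserving homeomorphism from `ℝ` onto the open arc `(x_1, x_2)` from
`x_1` to `x_2` anticlockwise: its angular coordinate is an increasing bijection from `ℝ` onto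
`(2 π / k, 4 π / k)`. For `k = 1` the arc is the circle without the point `x_1 = x_2 = 1`. -/
def IsArcParam (k : ℕ) (φ : ℝ → Circle) : Prop :=
  ∃ θ : ℝ ≃o Set.Ioo (2 * Real.pi * 1 / k) (2 * Real.pi * 2 / k),
    ∀ t, φ t = Circle.exp (θ t)

/-- The set `Homeo₊(S¹)_{k,g}` of the orientation preserving homeomorphisms `f` of the circle with
`f (x_j) = x_{j+1}` for `1 ≤ j ≤ k` and `f ^ k = φ g φ⁻¹` on the arc `(x_1, x_2)`. -/
def homeoKG (k : ℕ) (φ : ℝ → Circle) (g : HomeoPlusLine) : Set HomeoPlusCircle :=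
  {f | (∀ j ∈ Finset.Icc 1 k, f • rootPoint k j = rootPoint k (j + 1)) ∧
    ∀ t : ℝ, (f ^ k) • φ t = φ (g t)}

/-- A homeomorphism of the line that commutes with the translation by `2 π` induces one of the
circle. -/
theorem exists_descend (S : ℝ ≃o ℝ) (hS : ∀ t, S (t + 2 * Real.pi) = S t + 2 * Real.pi) :
    ∃ τ : HomeoPlusCircle, ∀ t : ℝ, τ • Circle.exp t = Circle.exp (S t) := by
  have hq : Topology.IsQuotientMap Circle.exp :=
    isLocalHomeomorph_circleExp.isOpenMap.isQuotientMap Circle.exp.continuous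
      Circle.exp_surjective
  have key : ∀ T : ℝ ≃o ℝ, (∀ t, T (t + 2 * Real.pi) = T t + 2 * Real.pi) →
      ∃ u : Circle → Circle, Continuous u ∧ ∀ t : ℝ, u (Circle.exp t) = Circle.exp (T t) := by
    intro T hT
    have hper : Function.Periodic (fun t => Circle.exp (T t)) (2 * Real.pi) := fun t => by
      simp only [hT]
      exact Circle.periodic_exp _
    have hu : ∀ t : ℝ, Circle.exp (T (Complex.arg (Circle.exp t))) = Circle.exp (T t) := by
      intro t
      obtain ⟨m, hm⟩ := Circle.exp_eq_exp.1 (Circle.exp_arg (Circle.exp t))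
      rw [hm]
      exact (hper.int_mul m) t
    refine ⟨fun z => Circle.exp (T (Complex.arg z)), ?_, hu⟩
    rw [hq.continuous_iff]
    have e : (fun z : Circle => Circle.exp (T (Complex.arg z))) ∘ Circle.exp =
        fun t => Circle.exp (T t) := funext hu
    rw [e]
    exact Circle.exp.continuous.comp T.continuous
  have hS' : ∀ t, S.symm (t + 2 * Real.pi) = S.symm t + 2 * Real.pi := by
    intro t
    rw [OrderIso.symm_apply_eq, hS, OrderIso.apply_symm_apply]
  obtain ⟨u, hu, hu'⟩ := key S hS
  obtain ⟨v, hv, hv'⟩ := key S.symm hS'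
  refine ⟨⟨⟨⟨u, v, ?_, ?_⟩, hu, hv⟩, S, hu'⟩, hu'⟩
  · intro z
    obtain ⟨t, rfl⟩ := Circle.exp_surjective z
    rw [hu', hv', OrderIso.symm_apply_apply]
  · intro z
    obtain ⟨t, rfl⟩ := Circle.exp_surjective z
    rw [hv', hu', OrderIso.apply_symm_apply]

/-- A lift of an orientation preserving homeomorphism of the circle has degree one. -/
theorem lift_add_two_pi (f : HomeoPlusCircle) (F : ℝ ≃o ℝ)
    (hF : ∀ t : ℝ, f • Circle.exp t = Circle.exp (F t)) (t : ℝ) :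
    F (t + 2 * Real.pi) = F t + 2 * Real.pi := by
  have hpi := Real.two_pi_pos
  have h1 : Circle.exp (F (t + 2 * Real.pi)) = Circle.exp (F t) := by
    rw [← hF, ← hF, Circle.exp_add_two_pi]
  obtain ⟨m, hm⟩ := Circle.exp_eq_exp.1 h1
  have hlt : F t < F (t + 2 * Real.pi) := F.strictMono (by linarith)
  have hm0 : (0 : ℝ) < m := by
    by_contra hcon
    have := mul_nonpos_of_nonpos_of_nonneg (not_lt.1 hcon) hpi.le
    linarith
  have hm1 : (1 : ℤ) ≤ m := by exact_mod_cast hm0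
  rcases eq_or_lt_of_le hm1 with h | h
  · rw [hm, ← h]; simp
  · exfalso
    have h2 : (2 : ℝ) ≤ m := by exact_mod_cast h
    set s := F.symm (F t + 2 * Real.pi) with hs
    have hFs : F s = F t + 2 * Real.pi := by rw [hs, OrderIso.apply_symm_apply]
    have hs1 : t < s := F.lt_iff_lt.1 (by rw [hFs]; linarith)
    have hs2 : s < t + 2 * Real.pi := F.lt_iff_lt.1 (by
      rw [hFs, hm]
      nlinarith)
    have h3 : f • Circle.exp s = f • Circle.exp t := by
      rw [hF, hF, hFs, Circle.exp_add_two_pi]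
    have h4 := MulAction.injective f h3
    obtain ⟨l, hl⟩ := Circle.exp_eq_exp.1 h4
    have a : (0 : ℝ) < l := by
      by_contra hcon
      have := mul_nonpos_of_nonpos_of_nonneg (not_lt.1 hcon) hpi.le
      linarith
    have b : (l : ℝ) < 1 := by
      by_contra hcon
      have := mul_le_mul_of_nonneg_right (not_lt.1 hcon) hpi.le
      linarith
    have a' : 0 < l := by exact_mod_cast a
    have b' : l < 1 := by exact_mod_cast b
    omega

/-- A homeomorphism of the circle that rotates the points `x_1, …, x_k` has a lift that moves
each angle `2 π j / k` to the next one. -/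
theorem exists_good_lift {k : ℕ} (hk : 1 ≤ k) (f : HomeoPlusCircle)
    (hf : ∀ j ∈ Finset.Icc 1 k, f • rootPoint k j = rootPoint k (j + 1)) :
    ∃ F : ℝ ≃o ℝ, (∀ t : ℝ, f • Circle.exp t = Circle.exp (F t)) ∧
      ∀ j ∈ Finset.Icc 1 k, F (2 * Real.pi / k * j) = 2 * Real.pi / k * (j + 1) := by
  have hpi := Real.two_pi_pos
  have hk0 : (0 : ℝ) < k := by exact_mod_cast hk
  have hc : 0 < 2 * Real.pi / k := by positivity
  have hck : 2 * Real.pi / k * k = 2 * Real.pi := by field_simp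
  have hroot : ∀ j, rootPoint k j = Circle.exp (2 * Real.pi / k * j) := fun j => by
    rw [rootPoint]; congr 1; ring
  obtain ⟨F0, hF0⟩ := f.2
  replace hF0 : ∀ t : ℝ, f • Circle.exp t = Circle.exp (F0 t) := hF0
  have ex : ∀ F : ℝ ≃o ℝ, (∀ t : ℝ, f • Circle.exp t = Circle.exp (F t)) →
      ∀ j ∈ Finset.Icc 1 k, ∃ m : ℤ,
        F (2 * Real.pi / k * j) = 2 * Real.pi / k * (j + 1) + m * (2 * Real.pi) := by
    intro F hF j hj
    have h := hf j hj
    rw [hroot, hroot, hF] at h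
    obtain ⟨m, hm⟩ := Circle.exp_eq_exp.1 h
    exact ⟨m, by rw [hm]; push_cast; ring⟩
  obtain ⟨m0, hm0⟩ := ex F0 hF0 1 (by simp [hk])
  let F : ℝ ≃o ℝ := F0.trans (OrderIso.addRight (-(m0 * (2 * Real.pi))))
  have hFa : ∀ t, F t = F0 t - m0 * (2 * Real.pi) := fun t => by
    simp [F, sub_eq_add_neg]
  have hF : ∀ t : ℝ, f • Circle.exp t = Circle.exp (F t) := by
    intro t
    rw [hF0, hFa]
    exact Circle.exp_eq_exp.2 ⟨m0, by ring⟩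
  have hF1 : F (2 * Real.pi / k) = 2 * Real.pi / k * 2 := by
    rw [hFa]
    simp only [Nat.cast_one, mul_one] at hm0
    rw [hm0]; ring
  refine ⟨F, hF, fun j hj => ?_⟩
  obtain ⟨m, hm⟩ := ex F hF j hj
  have hj1 : (1 : ℝ) ≤ j := by exact_mod_cast (Finset.mem_Icc.1 hj).1
  have hj2 : (j : ℝ) ≤ k := by exact_mod_cast (Finset.mem_Icc.1 hj).2
  have e1 := mul_le_mul_of_nonneg_left hj1 hc.le
  have e2 := mul_le_mul_of_nonneg_left hj2 hc.le
  have lo : F (2 * Real.pi / k) ≤ F (2 * Real.pi / k * j) := F.monotone (by linarith)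
  have hi : F (2 * Real.pi / k * j) < F (2 * Real.pi / k + 2 * Real.pi) :=
    F.strictMono (by linarith)
  rw [lift_add_two_pi f F hF, hF1] at hi
  rw [hF1] at lo
  have a : (m : ℝ) < 1 := by
    by_contra hcon
    have := mul_le_mul_of_nonneg_right (not_lt.1 hcon) hpi.le
    linarith
  have b : (-1 : ℝ) < m := by
    by_contra hcon
    have := mul_le_mul_of_nonneg_right (not_lt.1 hcon) hpi.le
    linarith
  have a' : m < 1 := by exact_mod_cast a
  have b' : -1 < m := by exact_mod_cast b
  have : m = 0 := by omega
  rw [hm, this]; simp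

/-- For `f` that rotates the points `x_1, …, x_k` and for `σ`, there is exactly one orientation
preserving homeomorphism of the circle that fixes every `x_j` and equals
`f^j φ σ φ⁻¹ f^(-j)` on the arc `f^j (x_1, x_2) = (x_{j+1}, x_{j+2})` for `0 ≤ j < k`. -/
theorem existsUnique_spread {k : ℕ} (hk : 1 ≤ k) {φ : ℝ → Circle} (hφ : IsArcParam k φ)
    {g : HomeoPlusLine} {f : HomeoPlusCircle} (hf : f ∈ homeoKG k φ g) (σ : HomeoPlusLine) :
    ∃! τ : HomeoPlusCircle, (∀ j ∈ Finset.Icc 1 k, τ • rootPoint k j = rootPoint k j) ∧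
      ∀ j < k, ∀ t : ℝ, τ • ((f ^ j) • φ t) = (f ^ j) • φ (σ t) := by
  have hpi := Real.two_pi_pos
  have hk0 : (0 : ℝ) < k := by exact_mod_cast hk
  have hkz : (0 : ℤ) < k := by exact_mod_cast hk
  obtain ⟨F, hF, hFj⟩ := exists_good_lift hk f hf.1
  obtain ⟨θ, hθ⟩ := hφ
  set c : ℝ := 2 * Real.pi / k with hcdef
  have hc : 0 < c := by positivity
  have hck : c * k = 2 * Real.pi := by rw [hcdef]; field_simp
  have hroot : ∀ j, rootPoint k j = Circle.exp (c * j) := fun j => by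
    rw [rootPoint, hcdef]; congr 1; ring
  have hpow : ∀ (j : ℕ) (t : ℝ), (f ^ j) • Circle.exp t = Circle.exp ((F ^ j) t) := by
    intro j
    induction j with
    | zero => intro t; simp
    | succ j ih => intro t; rw [pow_succ', mul_smul, ih, hF, pow_succ']; rfl
  have hgrid : ∀ i : ℕ, ∀ j : ℕ, 1 ≤ j → i + j ≤ k + 1 → (F ^ i) (c * j) = c * (j + i) := by
    intro i
    induction i with
    | zero => intro j _ _; simp
    | succ i ih =>
      intro j h1 h2
      have e : (F ^ (i + 1)) (c * j) = F ((F ^ i) (c * j)) := by rw [pow_succ']; rfl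
      rw [e, ih j h1 (by omega)]
      have := hFj (j + i) (Finset.mem_Icc.2 ⟨by omega, by omega⟩)
      push_cast at this ⊢
      rw [this]; ring
  -- the parametrization of the interval number `j`, with `j - 1 = i + k q`, `0 ≤ i < k`
  let P : ℤ → ℝ → ℝ := fun j t =>
    (F ^ ((j - 1) % k).toNat) (θ t : ℝ) + c * (k * (((j - 1) / k : ℤ) : ℝ))
  have hP : ∀ j, StrictMono (P j) := by
    intro j a b hab
    have h1 : (θ a : ℝ) < θ b := θ.strictMono hab
    have h2 := (F ^ ((j - 1) % k).toNat).strictMono h1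
    simpa [P] using h2
  have hθr : Set.range (fun t => (θ t : ℝ)) = Set.Ioo (c * (1 : ℕ)) (c * (2 : ℕ)) := by
    have e1 : c * (1 : ℕ) = 2 * Real.pi * 1 / k := by rw [hcdef]; push_cast; ring
    have e2 : c * (2 : ℕ) = 2 * Real.pi * 2 / k := by rw [hcdef]; push_cast; ring
    rw [e1, e2]
    ext x
    constructor
    · rintro ⟨t, rfl⟩; exact (θ t).2
    · intro hx; exact ⟨θ.symm ⟨x, hx⟩, by simp⟩
  have hr : ∀ j : ℤ, Set.range (P j) = Set.Ioo (c * j) (c * (j + 1)) := by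
    intro j
    have i0 : 0 ≤ (j - 1) % k := Int.emod_nonneg _ hkz.ne'
    have i1 : (j - 1) % k < k := Int.emod_lt_of_pos _ hkz
    have dm : (j - 1) % k + k * ((j - 1) / k) = j - 1 := Int.emod_add_mul_ediv _ _
    set i := ((j - 1) % k).toNat with hi
    have hii : (i : ℤ) = (j - 1) % k := Int.toNat_of_nonneg i0
    have hik : i < k := by omega
    set q : ℤ := (j - 1) / k with hq
    have hij : (i : ℝ) + k * q = j - 1 := by
      rw [← hii] at dm; exact_mod_cast dm
    have e : P j = (fun x => x + c * (k * (q : ℝ))) ∘ (F ^ i) ∘ (fun t => (θ t : ℝ)) := rfl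
    rw [e, Set.range_comp, Set.range_comp, hθr, OrderIso.image_Ioo,
      hgrid i 1 le_rfl (by omega), hgrid i 2 (by omega) (by omega), Set.image_add_const_Ioo]
    congr 1
    · push_cast; linear_combination c * hij
    · push_cast; linear_combination c * hij
  obtain ⟨S, hS1, hS2⟩ := exists_glue hc P (fun j => Or.inl (hP j)) hr σ
  have hPk : ∀ j t, P j t + 2 * Real.pi = P (j + k) t := by
    intro j t
    have e1 : (j + k - 1) % (k : ℤ) = (j - 1) % k := by
      rw [show j + k - 1 = (j - 1) + k by ring, Int.add_emod_right]
    have e2 : (j + k - 1) / (k : ℤ) = (j - 1) / k + 1 := by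
      rw [show j + k - 1 = (j - 1) + k * 1 by ring, Int.add_mul_ediv_left _ _ hkz.ne']
    simp only [P]
    rw [e1, e2]
    push_cast; linear_combination -hck
  have hcases : ∀ x : ℝ, (∃ j : ℤ, x = c * j) ∨ ∃ j t, x = P j t := by
    intro x
    rcases grid_cases hc x with h | ⟨j, h⟩
    · exact Or.inl h
    · rw [← hr] at h
      obtain ⟨t, ht⟩ := h
      exact Or.inr ⟨j, t, ht.symm⟩
  have hSper : ∀ t, S (t + 2 * Real.pi) = S t + 2 * Real.pi := by
    intro x
    rcases hcases x with ⟨j, rfl⟩ | ⟨j, t, rfl⟩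
    · have e : c * (j : ℝ) + 2 * Real.pi = c * ((j + k : ℤ) : ℝ) := by
        rw [← hck]; push_cast; ring
      rw [hS1, e, hS1]
    · rw [hPk, hS2, hS2, hPk]
  have hPi : ∀ j < k, ∀ t, Circle.exp (P (j + 1) t) = (f ^ j) • φ t := by
    intro j hj t
    have hjz : (j : ℤ) < k := by exact_mod_cast hj
    have e1 : ((j : ℤ) + 1 - 1) % k = j := by
      rw [add_sub_cancel_right, Int.emod_eq_of_lt (by omega) hjz]
    have e2 : ((j : ℤ) + 1 - 1) / k = 0 := by
      rw [add_sub_cancel_right, Int.ediv_eq_zero_of_lt (by omega) hjz]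
    simp only [P]
    rw [e1, e2, hθ, hpow]
    simp
  obtain ⟨τ, hτ⟩ := exists_descend S hSper
  have hτ1 : ∀ j ∈ Finset.Icc 1 k, τ • rootPoint k j = rootPoint k j := by
    intro j _
    rw [hroot, hτ]
    have := hS1 j
    push_cast at this
    rw [this]
  have hτ2 : ∀ j < k, ∀ t : ℝ, τ • ((f ^ j) • φ t) = (f ^ j) • φ (σ t) := by
    intro j hj t
    rw [← hPi j hj, hτ, hS2, hPi j hj]
  refine ⟨τ, ⟨hτ1, hτ2⟩, ?_⟩
  rintro ρ ⟨hρ1, hρ2⟩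
  have cover : ∀ z : Circle, (∃ j ∈ Finset.Icc 1 k, z = rootPoint k j) ∨
      ∃ j < k, ∃ t, z = (f ^ j) • φ t := by
    intro z
    obtain ⟨x, rfl⟩ := Circle.exp_surjective z
    have shift : ∀ j : ℤ, ∃ i : ℕ, i < k ∧ ∃ q : ℤ, j = (i + 1 : ℤ) + k * q := by
      intro j
      have i0 : 0 ≤ (j - 1) % k := Int.emod_nonneg _ hkz.ne'
      have i1 : (j - 1) % k < k := Int.emod_lt_of_pos _ hkz
      have dm : (j - 1) % k + k * ((j - 1) / k) = j - 1 := Int.emod_add_mul_ediv _ _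
      refine ⟨((j - 1) % k).toNat, by omega, (j - 1) / k, ?_⟩
      rw [Int.toNat_of_nonneg i0]
      linarith
    have hPq : ∀ (q j : ℤ) t, Circle.exp (P (j + k * q) t) = Circle.exp (P j t) := by
      intro q j t
      have e1 : (j + k * q - 1) % (k : ℤ) = (j - 1) % k := by
        rw [show j + k * q - 1 = (j - 1) + k * q by ring, Int.add_mul_emod_self_left]
      have e2 : (j + k * q - 1) / (k : ℤ) = (j - 1) / k + q := by
        rw [show j + k * q - 1 = (j - 1) + k * q by ring, Int.add_mul_ediv_left _ _ hkz.ne']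
      refine Circle.exp_eq_exp.2 ⟨q, ?_⟩
      simp only [P]
      rw [e1, e2]
      push_cast; linear_combination (q : ℝ) * hck
    rcases hcases x with ⟨j, rfl⟩ | ⟨j, t, rfl⟩
    · left
      obtain ⟨i, hi, q, hq⟩ := shift j
      refine ⟨i + 1, Finset.mem_Icc.2 ⟨by omega, by omega⟩, ?_⟩
      rw [hroot]
      refine Circle.exp_eq_exp.2 ⟨q, ?_⟩
      rw [hq, ← hck]
      push_cast; ring
    · right
      obtain ⟨i, hi, q, hq⟩ := shift j
      exact ⟨i, hi, t, by rw [hq, hPq, hPi i hi]⟩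
  apply Subtype.ext
  ext1 z
  change ρ • z = τ • z
  rcases cover z with ⟨j, hj, rfl⟩ | ⟨j, hj, t, rfl⟩
  · rw [hρ1 j hj, hτ1 j hj]
  · rw [hρ2 j hj, hτ2 j hj]

/-- The homeomorphism `σ̄ = σ̄^f` of the circle: it fixes `x_1, …, x_k` and it equals
`f^(j-1) φ σ φ⁻¹ f^(-(j-1))` on the arc `(x_j, x_{j+1}) = f^(j-1) (x_1, x_2)`, `1 ≤ j ≤ k`. -/
noncomputable def spread {k : ℕ} (hk : 1 ≤ k) {φ : ℝ → Circle} (hφ : IsArcParam k φ)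
    {g : HomeoPlusLine} {f : HomeoPlusCircle} (hf : f ∈ homeoKG k φ g)
    (σ : HomeoPlusLine) : HomeoPlusCircle :=
  (existsUnique_spread hk hφ hf σ).choose

/-- The group `G_{α,n,k,g,f}` for `A = G_{α,n}`: it is generated by `f` and all `σ̄`, `σ ∈ A`. -/
noncomputable def circleGroup (A : Subgroup HomeoPlusLine) {k : ℕ} (hk : 1 ≤ k) {φ : ℝ → Circle}
    (hφ : IsArcParam k φ) {g : HomeoPlusLine} {f : HomeoPlusCircle}
    (hf : f ∈ homeoKG k φ g) : Subgroup HomeoPlusCircle :=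
  Subgroup.closure (spread hk hφ hf '' (A : Set HomeoPlusLine) ∪ {f})

end TightCircle

namespace TightCircle

/-! ### Fixed points of homeomorphisms of the line -/

/-! Pass to the universal cover. Commuting homeomorphisms of the circle have commuting lifts, so all
lifts of elements of `G` form a commutative group `A ≅ ℤⁿ⁺¹` acting faithfully on the line and
containing the deck transformation `L`, the translation by `2π`. Almost minimality lifts. Tightness
lifts only in a relative form, `TightAt r L`: no subgroup of infinite index containing `L` is
transitive. This form suffices and survives the induction.

On the line there is a dichotomy (`LineAlmostMinimal.dichotomy`). If the action is free, Hölder's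
theorem makes it a dense group of translations. The distinguished element and one suitable further
element already generate a dense subgroup, so tightness forces rank two, and rescaling gives `⟨L_1,
L_α⟩`. Otherwise some nontrivial element has a fixed point. The elements with fixed points form a
subgroup whose common fixed point set is nonempty, closed, invariant and proper, hence countable by
almost minimality. Thus it has an isolated point `c`, and the orbit of `c` is the orbit under a
single fixed point free `t`. Then `A` is the direct product of `⟨t⟩` and the stabilizer of `c`. The
stabilizer acts on `(c, t c) ≅ ℝ`, faithfully and almost minimally, it is tight at the component `κ`
of `g = t ^ m * κ`, and its rank is one less. Induction on the rank gives `G_{α,n}`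
(`exists_conj_lineGroup`), since gluing copies of the stabilizer action along the orbit of `c` is
the operation `ħ`.

On the circle the lifts have rank `n + 1 ≥ 3`, so the orbit is discrete and `L = t ^ k * κ₀` with `k
≥ 1` and `κ₀` in the stabilizer, whose action is conjugate to `G_{α,n}`. The element `t` descends to
`f`, and `t ^ k = L * κ₀⁻¹` shows that `g` corresponds to `κ₀⁻¹`. If `κ₀⁻¹` were an `s`-th power
with `d = gcd(k, s) ≠ 1`, then `L` would be a `d`-th power in `A`, which is impossible because `G`
is torsion free. -/

theorem lt_of_apply_lt (T : HomeoPlusLine) {x y : ℝ} (h : T x < T y) : x < y :=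
  T.lt_iff_lt.1 h

theorem zpow_add_apply (T : HomeoPlusLine) (m n : ℤ) (x : ℝ) :
    (T ^ (m + n)) x = (T ^ m) ((T ^ n) x) := by
  rw [zpow_add]; rfl

theorem zpow_succ_apply (T : HomeoPlusLine) (m : ℤ) (x : ℝ) :
    (T ^ (m + 1)) x = T ((T ^ m) x) := by
  rw [add_comm, zpow_add, zpow_one]; rfl

theorem zpow_neg_apply_apply (T : HomeoPlusLine) (m : ℤ) (x : ℝ) :
    (T ^ (-m)) ((T ^ m) x) = x := by
  rw [← zpow_add_apply]; simp

theorem zpow_apply_neg_apply (T : HomeoPlusLine) (m : ℤ) (x : ℝ) :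
    (T ^ m) ((T ^ (-m)) x) = x := by
  rw [← zpow_add_apply]; simp

theorem apply_apply_comm {S T : HomeoPlusLine} (h : S * T = T * S) (x : ℝ) :
    S (T x) = T (S x) :=
  DFunLike.congr_fun h x

/-- The supremum of an invariant nonempty bounded set is a fixed point. -/
theorem apply_csSup_eq (T : HomeoPlusLine) {s : Set ℝ} (hs : s.Nonempty) (hb : BddAbove s)
    (h : ∀ x, x ∈ s ↔ T x ∈ s) : T (sSup s) = sSup s := by
  apply le_antisymm
  · rw [← T.le_symm_apply]
    refine csSup_le hs fun x hx => ?_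
    rw [T.le_symm_apply]
    exact le_csSup hb ((h x).1 hx)
  · refine csSup_le hs fun x hx => ?_
    rw [← T.symm_apply_le]
    refine le_csSup hb ?_
    rw [h, T.apply_symm_apply]
    exact hx

/-- The infimum of an invariant nonempty bounded set is a fixed point. -/
theorem apply_csInf_eq (T : HomeoPlusLine) {s : Set ℝ} (hs : s.Nonempty) (hb : BddBelow s)
    (h : ∀ x, x ∈ s ↔ T x ∈ s) : T (sInf s) = sInf s := by
  apply le_antisymm
  · refine le_csInf hs fun x hx => ?_
    rw [← T.le_symm_apply]
    refine csInf_le hb ?_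
    rw [h, T.apply_symm_apply]
    exact hx
  · rw [← T.symm_apply_le]
    refine le_csInf hs fun x hx => ?_
    rw [T.symm_apply_le]
    exact csInf_le hb ((h x).1 hx)

theorem mem_range_zpow_iff (T : HomeoPlusLine) (c x : ℝ) :
    x ∈ Set.range (fun m : ℤ => (T ^ m) c) ↔ T x ∈ Set.range (fun m : ℤ => (T ^ m) c) := by
  constructor
  · rintro ⟨m, rfl⟩
    exact ⟨m + 1, zpow_succ_apply T m c⟩
  · rintro ⟨m, hm⟩
    refine ⟨m - 1, T.injective ?_⟩
    simp only at hm ⊢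
    rw [← zpow_succ_apply, sub_add_cancel, hm]

theorem strictMono_zpow_apply {T : HomeoPlusLine} {c : ℝ} (hc : c < T c) :
    StrictMono (fun m : ℤ => (T ^ m) c) := by
  refine strictMono_int_of_lt_succ fun m => ?_
  rw [zpow_add_apply, zpow_one]
  exact (T ^ m).strictMono hc

/-- The orbit of a homeomorphism without fixed points cuts the line into consecutive
intervals. -/
theorem exists_zpow_le_lt {T : HomeoPlusLine} (hT : ∀ x, T x ≠ x) {c : ℝ} (hc : c < T c)
    (x : ℝ) : ∃ m : ℤ, (T ^ m) c ≤ x ∧ x < (T ^ (m + 1)) c := by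
  have hne : (Set.range (fun m : ℤ => (T ^ m) c)).Nonempty := ⟨_, 0, rfl⟩
  -- A bounded orbit would have a supremum or an infimum fixed by `T`, so the orbit is unbounded in
  -- both directions.
  have h1 : ∃ b : ℤ, x < (T ^ b) c := by
    by_contra! hcon
    exact hT _ (apply_csSup_eq T hne ⟨x, by rintro _ ⟨m, rfl⟩; exact hcon m⟩
      (mem_range_zpow_iff T c))
  have h2 : ∃ b : ℤ, (T ^ b) c ≤ x := by
    by_contra! hcon
    exact hT _ (apply_csInf_eq T hne ⟨x, by rintro _ ⟨m, rfl⟩; exact (hcon m).le⟩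
      (mem_range_zpow_iff T c))
  obtain ⟨b, hb⟩ := h1
  obtain ⟨m, hm, hm'⟩ := Int.exists_greatest_of_bdd (P := fun m : ℤ => (T ^ m) c ≤ x)
    ⟨b, fun z hz => ((strictMono_zpow_apply hc).lt_iff_lt.1 (lt_of_le_of_lt hz hb)).le⟩ h2
  refine ⟨m, hm, ?_⟩
  by_contra hcon
  have := hm' _ (not_lt.1 hcon)
  omega

/-- Finitely many commuting homeomorphisms of the line, each of which has a fixed point, have
a common one. -/
theorem exists_common_fixed_point (s : Finset HomeoPlusLine)
    (hcomm : ∀ S ∈ s, ∀ T ∈ s, S * T = T * S) (hfix : ∀ S ∈ s, ∃ x, S x = x) :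
    ∃ x, ∀ S ∈ s, S x = x := by
  classical
  induction s using Finset.induction_on with
  | empty => exact ⟨0, by simp⟩
  | insert T s hTs ih =>
    obtain ⟨p, hp⟩ := ih
      (fun S hS R hR => hcomm S (Finset.mem_insert_of_mem hS) R (Finset.mem_insert_of_mem hR))
      (fun S hS => hfix S (Finset.mem_insert_of_mem hS))
    obtain ⟨q, hq⟩ := hfix T (Finset.mem_insert_self _ _)
    have hqm : ∀ m : ℤ, (T ^ m) q = q := by
      have h1 : ∀ n : ℕ, (T ^ n) q = q := by
        intro n
        induction n with
        | zero => rfl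
        | succ n ihn => rw [pow_succ]; change (T ^ n) (T q) = q; rw [hq, ihn]
      intro m
      obtain ⟨n, rfl | rfl⟩ := m.eq_nat_or_neg
      · rw [zpow_natCast]; exact h1 n
      · conv_lhs => rw [← h1 n]
        rw [← zpow_natCast]
        exact zpow_neg_apply_apply T n q
    -- By commutation the whole `T`-orbit of `p` is fixed by `s`. A fixed point `q` of `T` bounds
    -- this orbit on one side, and the extremum on that side is fixed by `T` as well.
    have hS : ∀ S ∈ s, ∀ m : ℤ, S ((T ^ m) p) = (T ^ m) p := by
      intro S hS m
      have h : S * T ^ m = T ^ m * S := (show Commute S T from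
        hcomm S (Finset.mem_insert_of_mem hS) T (Finset.mem_insert_self _ _)).zpow_right m
      rw [apply_apply_comm h, hp S hS]
    have hne : (Set.range (fun m : ℤ => (T ^ m) p)).Nonempty := ⟨_, 0, rfl⟩
    have hiff : ∀ S ∈ s, ∀ x, x ∈ Set.range (fun m : ℤ => (T ^ m) p) ↔
        S x ∈ Set.range (fun m : ℤ => (T ^ m) p) := by
      intro S hSs x
      constructor
      · rintro ⟨m, rfl⟩
        exact ⟨m, (hS S hSs m).symm⟩
      · rintro ⟨m, hm⟩
        refine ⟨m, S.injective ?_⟩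
        rw [← hm]
        exact hS S hSs m
    rcases le_total p q with h | h
    · have hb : BddAbove (Set.range (fun m : ℤ => (T ^ m) p)) :=
        ⟨q, by rintro _ ⟨m, rfl⟩; rw [← hqm m]; exact (T ^ m).monotone h⟩
      refine ⟨sSup (Set.range (fun m : ℤ => (T ^ m) p)), fun S hSs => ?_⟩
      rcases Finset.mem_insert.1 hSs with rfl | h'
      · exact apply_csSup_eq _ hne hb (mem_range_zpow_iff _ _)
      · exact apply_csSup_eq S hne hb (hiff S h')
    · have hb : BddBelow (Set.range (fun m : ℤ => (T ^ m) p)) :=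
        ⟨q, by rintro _ ⟨m, rfl⟩; rw [← hqm m]; exact (T ^ m).monotone h⟩
      refine ⟨sInf (Set.range (fun m : ℤ => (T ^ m) p)), fun S hSs => ?_⟩
      rcases Finset.mem_insert.1 hSs with rfl | h'
      · exact apply_csInf_eq _ hne hb (mem_range_zpow_iff _ _)
      · exact apply_csInf_eq S hne hb (hiff S h')

/-! ### Gluing along two subdivisions of the line -/

/-- If two subdivisions of the line are given and corresponding intervals are parametrized
compatibly, the parametrizations glue to a homeomorphism of the line. -/
theorem exists_glue_subdivision (p q : ℤ → ℝ) (hp : StrictMono p) (hq : StrictMono q)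
    (hpc : ∀ x, ∃ m, p m ≤ x ∧ x < p (m + 1)) (hqc : ∀ x, ∃ m, q m ≤ x ∧ x < q (m + 1))
    (P Q : ℤ → ℝ → ℝ)
    (hPQ : ∀ j s t, P j s < P j t ↔ Q j s < Q j t)
    (hP : ∀ j, Set.range (P j) = Set.Ioo (p j) (p (j + 1)))
    (hQ : ∀ j, Set.range (Q j) = Set.Ioo (q j) (q (j + 1))) :
    ∃ Ψ : HomeoPlusLine, (∀ j, Ψ (p j) = q j) ∧ ∀ j t, Ψ (P j t) = Q j t := by
  classical
  -- The hypotheses are symmetric in the two subdivisions, so the inverse comes from the same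
  -- construction with the roles exchanged. Comparing the orders of `P j` and `Q j` only with each
  -- other allows decreasing parametrizations.
  have key : ∀ (p q : ℤ → ℝ), StrictMono p → StrictMono q →
      (∀ x, ∃ m, p m ≤ x ∧ x < p (m + 1)) →
      ∀ P Q : ℤ → ℝ → ℝ, (∀ j s t, P j s < P j t ↔ Q j s < Q j t) →
      (∀ j, Set.range (P j) = Set.Ioo (p j) (p (j + 1))) →
      (∀ j, Set.range (Q j) = Set.Ioo (q j) (q (j + 1))) →
      ∃ f : ℝ → ℝ, StrictMono f ∧ (∀ j, f (p j) = q j) ∧ ∀ j t, f (P j t) = Q j t := by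
    intro p q hp hq hpc P Q hPQ hP hQ
    have cases : ∀ x, ∃ j, x = p j ∨ ∃ t, x = P j t := by
      intro x
      obtain ⟨j, h1, h2⟩ := hpc x
      rcases eq_or_lt_of_le h1 with h | h
      · exact ⟨j, Or.inl h.symm⟩
      · have : x ∈ Set.range (P j) := by rw [hP]; exact ⟨h, h2⟩
        obtain ⟨t, ht⟩ := this
        exact ⟨j, Or.inr ⟨t, ht.symm⟩⟩
    have hPm : ∀ j t, p j < P j t ∧ P j t < p (j + 1) := fun j t => by
      have : P j t ∈ Set.Ioo (p j) (p (j + 1)) := by rw [← hP]; exact ⟨t, rfl⟩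
      exact this
    have hQm : ∀ j t, q j < Q j t ∧ Q j t < q (j + 1) := fun j t => by
      have : Q j t ∈ Set.Ioo (q j) (q (j + 1)) := by rw [← hQ]; exact ⟨t, rfl⟩
      exact this
    let R : ℝ → ℝ → Prop := fun x y =>
      (∃ j, x = p j ∧ y = q j) ∨ ∃ j t, x = P j t ∧ y = Q j t
    have hR : ∀ x, ∃ y, R x y := by
      intro x
      obtain ⟨j, h | ⟨t, h⟩⟩ := cases x
      · exact ⟨q j, Or.inl ⟨j, h, rfl⟩⟩
      · exact ⟨Q j t, Or.inr ⟨j, t, h, rfl⟩⟩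
    have hmono : ∀ x y x' y', R x y → R x' y' → x < x' → y < y' := by
      rintro x y x' y' (⟨j, rfl, rfl⟩ | ⟨j, t, rfl, rfl⟩) (⟨l, rfl, rfl⟩ | ⟨l, s, rfl, rfl⟩) hlt
      · exact hq (hp.lt_iff_lt.1 hlt)
      · have : j < l + 1 := hp.lt_iff_lt.1 (hlt.trans (hPm l s).2)
        exact lt_of_le_of_lt (hq.monotone (by omega)) (hQm l s).1
      · have : j < l := hp.lt_iff_lt.1 ((hPm j t).1.trans hlt)
        exact lt_of_lt_of_le (hQm j t).2 (hq.monotone (by omega))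
      · have : j < l + 1 := hp.lt_iff_lt.1 ((hPm j t).1.trans (hlt.trans (hPm l s).2))
        rcases eq_or_lt_of_le (show j ≤ l by omega) with rfl | h
        · exact (hPQ j t s).1 hlt
        · exact (hQm j t).2.trans (lt_of_le_of_lt (hq.monotone (by omega)) (hQm l s).1)
    choose f hf using hR
    have hfm : StrictMono f := fun x y hxy => hmono _ _ _ _ (hf x) (hf y) hxy
    have huniq : ∀ x y, R x y → f x = y := by
      rintro _ y (⟨j, rfl, rfl⟩ | ⟨j, t, rfl, rfl⟩)
      · rcases hf (p j) with ⟨l, h1, h2⟩ | ⟨l, s, h1, h2⟩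
        · rw [h2, hp.injective h1]
        · exfalso
          have a := hPm l s
          rw [← h1] at a
          have := hp.lt_iff_lt.1 a.1
          have := hp.lt_iff_lt.1 a.2
          omega
      · rcases hf (P j t) with ⟨l, h1, h2⟩ | ⟨l, s, h1, h2⟩
        · exfalso
          have a := hPm j t
          rw [h1] at a
          have := hp.lt_iff_lt.1 a.1
          have := hp.lt_iff_lt.1 a.2
          omega
        · have a := hPm j t
          have b := hPm l s
          rw [← h1] at b
          have := hp.lt_iff_lt.1 (a.1.trans b.2)
          have := hp.lt_iff_lt.1 (b.1.trans a.2)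
          obtain rfl : j = l := by omega
          rw [h2]
          apply le_antisymm
          · by_contra hcon
            have := (hPQ j t s).2 (not_le.1 hcon)
            exact this.ne h1
          · by_contra hcon
            have := (hPQ j s t).2 (not_le.1 hcon)
            exact this.ne h1.symm
    exact ⟨f, hfm, fun j => huniq _ _ (Or.inl ⟨j, rfl, rfl⟩),
      fun j t => huniq _ _ (Or.inr ⟨j, t, rfl, rfl⟩)⟩
  obtain ⟨f, hfm, hf1, hf2⟩ := key p q hp hq hpc P Q hPQ hP hQ
  obtain ⟨f', hfm', hf1', hf2'⟩ := key q p hq hp hqc Q P (fun j s t => (hPQ j s t).symm) hQ hP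
  have hinv : Function.RightInverse f' f := by
    intro x
    obtain ⟨j, h1, h2⟩ := hqc x
    rcases eq_or_lt_of_le h1 with h | h
    · rw [← h, hf1', hf1]
    · have : x ∈ Set.range (Q j) := by rw [hQ]; exact ⟨h, h2⟩
      obtain ⟨t, rfl⟩ := this
      rw [hf2', hf2]
  exact ⟨hfm.orderIsoOfRightInverse f f' hinv, hf1, hf2⟩

/-! ### Actions on the line -/

/-- The subgroup `F` of a group acting on the line through `r` acts topologically transitively. -/
def LineTransitive {A : Type} [CommGroup A] (r : A →* HomeoPlusLine) (F : Subgroup A) : Prop :=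
  ∀ U V : Set ℝ, IsOpen U → U.Nonempty → IsOpen V → V.Nonempty → ∃ a ∈ F, ∃ x ∈ U, r a x ∈ V

/-- At most countably many points of the line have a non-dense orbit. -/
def LineAlmostMinimal {A : Type} [CommGroup A] (r : A →* HomeoPlusLine) : Prop :=
  {x : ℝ | ¬ Dense (Set.range fun a => r a x)}.Countable

/-- No subgroup of infinite index that contains `g` acts topologically transitively. -/
def TightAt {A : Type} [CommGroup A] (r : A →* HomeoPlusLine) (g : A) : Prop :=
  ∀ F : Subgroup A, g ∈ F → F.index = 0 → ¬ LineTransitive r F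

section

variable {A : Type} [CommGroup A] {r : A →* HomeoPlusLine}

theorem hom_mul_apply (r : A →* HomeoPlusLine) (a b : A) (x : ℝ) : r (a * b) x = r a (r b x) := by
  rw [map_mul]; rfl

theorem hom_inv_apply_apply (r : A →* HomeoPlusLine) (a : A) (x : ℝ) : r a⁻¹ (r a x) = x := by
  rw [← hom_mul_apply]; simp

theorem hom_apply_inv_apply (r : A →* HomeoPlusLine) (a : A) (x : ℝ) : r a (r a⁻¹ x) = x := by
  rw [← hom_mul_apply]; simp

theorem hom_apply_comm (r : A →* HomeoPlusLine) (a b : A) (x : ℝ) :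
    r a (r b x) = r b (r a x) := by
  rw [← hom_mul_apply, mul_comm, hom_mul_apply]

theorem LineAlmostMinimal.exists_mem_dense (hr : LineAlmostMinimal r) {U : Set ℝ}
    (hU : IsOpen U) (hne : U.Nonempty) : ∃ x ∈ U, Dense (Set.range fun a => r a x) := by
  obtain ⟨x, hx, hx'⟩ := (Set.Countable.dense_compl ℝ hr).inter_open_nonempty U hU hne
  exact ⟨x, hx, not_not.1 hx'⟩

theorem LineAlmostMinimal.lineTransitive (hr : LineAlmostMinimal r) : LineTransitive r ⊤ := by
  intro U V hU hU' hV hV'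
  obtain ⟨x, hx, hd⟩ := hr.exists_mem_dense hU hU'
  obtain ⟨_, hy, a, rfl⟩ := hd.inter_open_nonempty V hV hV'
  exact ⟨a, trivial, x, hx, hy⟩

theorem LineAlmostMinimal.not_fixed (hr : LineAlmostMinimal r) (p : ℝ) :
    ∃ a, r a p ≠ p := by
  by_contra! hcon
  obtain ⟨a, -, x, hx, hy⟩ := hr.lineTransitive (Set.Iio p) (Set.Ioi p) isOpen_Iio
    Set.nonempty_Iio isOpen_Ioi Set.nonempty_Ioi
  have := (r a).strictMono hx
  rw [hcon a] at this
  exact lt_asymm this hy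

/-- A closed invariant set other than the line is countable for an almost minimal action. -/
theorem LineAlmostMinimal.countable_of_isClosed (hr : LineAlmostMinimal r) {C : Set ℝ}
    (hC : IsClosed C) (hinv : ∀ a, ∀ x ∈ C, r a x ∈ C) (hne : C ≠ Set.univ) : C.Countable := by
  have hsub : C ⊆ {x : ℝ | ¬ Dense (Set.range fun a => r a x)} := by
    intro x hx hd
    refine hne ?_
    have := hd.closure_eq
    rw [← Set.univ_subset_iff, ← this]
    exact hC.closure_subset_iff.2 (by rintro _ ⟨a, rfl⟩; exact hinv a x hx)
  exact Set.Countable.mono hsub hr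

/-- A nonempty countable closed set of reals has an isolated point. -/
theorem exists_isolated {C : Set ℝ} (hC : IsClosed C) (hcount : C.Countable)
    (hne : C.Nonempty) : ∃ c ∈ C, ∃ ε > 0, ∀ y ∈ C, |y - c| < ε → y = c := by
  by_contra! hcon
  -- Without isolated points `C` would be perfect and contain a copy of the uncountable space `ℕ →
  -- Bool`.
  have hperf : Perfect C := by
    refine ⟨hC, ?_⟩
    rw [preperfect_iff_nhds]
    intro x hx U hU
    obtain ⟨ε, hε, hεU⟩ := Metric.mem_nhds_iff.1 hU
    obtain ⟨y, hy, hy1, hy2⟩ := hcon x hx ε hε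
    exact ⟨y, ⟨hεU (by rwa [Metric.mem_ball, Real.dist_eq]), hy⟩, hy2⟩
  obtain ⟨f, hf, -, hinj⟩ := hperf.exists_nat_bool_injection hne
  have h1 : Countable (ℕ → Bool) := by
    have := hcount.mono hf
    rw [← Set.image_univ] at this
    exact Set.countable_univ_iff.1 (Set.countable_of_injective_of_countable_image
      hinj.injOn this)
  rw [← Cardinal.mk_le_aleph0_iff] at h1
  have h2 : Cardinal.aleph0 < Cardinal.mk (ℕ → Bool) := by
    simpa using Cardinal.cantor Cardinal.aleph0
  exact absurd h2 (not_lt.2 h1)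

/-- If some nontrivial element has a fixed point, all orbits of a suitable point are orbits of a
single homeomorphism without fixed points. -/
theorem LineAlmostMinimal.exists_discrete_orbit (hr : LineAlmostMinimal r)
    (hinj : Function.Injective r) [hfin : Module.Finite ℤ (Additive A)]
    (hk : ∃ a, a ≠ 1 ∧ ∃ x, r a x = x) :
    ∃ (t : A) (c : ℝ), c < r t c ∧ (∀ x, r t x ≠ x) ∧ ∀ a, ∃ m : ℤ, r a c = (r t ^ m) c := by
  classical
  have hcomm : ∀ a b : A, r a * r b = r b * r a := fun a b => by
    rw [← map_mul, mul_comm, map_mul]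
  -- Closure under products holds because two commuting homeomorphisms with fixed points share one.
  let K : Subgroup A :=
    { carrier := {a | ∃ x, r a x = x}
      one_mem' := ⟨0, by simp⟩
      mul_mem' := by
        intro a b ha hb
        obtain ⟨x, hx⟩ := exists_common_fixed_point {r a, r b}
          (by intro S hS T hT
              simp only [Finset.mem_insert, Finset.mem_singleton] at hS hT
              rcases hS with rfl | rfl <;> rcases hT with rfl | rfl <;> apply hcomm)
          (by intro S hS
              simp only [Finset.mem_insert, Finset.mem_singleton] at hS
              rcases hS with rfl | rfl
              · exact ha
              · exact hb)
        refine ⟨x, ?_⟩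
        rw [hom_mul_apply, hx _ (by simp), hx _ (by simp)]
      inv_mem' := by
        rintro a ⟨x, hx⟩
        refine ⟨x, ?_⟩
        conv_lhs => rw [← hx]
        exact hom_inv_apply_apply r a x }
  -- Finite generation makes one point fixed by all of `K`, not just by each element separately.
  have hKfg : K.FG := by
    have h1 : (AddSubgroup.toIntSubmodule (Subgroup.toAddSubgroup K)).FG :=
      IsNoetherian.noetherian _
    rw [Submodule.fg_iff_addSubgroup_fg, AddSubgroup.toIntSubmodule_toAddSubgroup] at h1
    exact (Subgroup.fg_iff_add_fg K).2 h1
  obtain ⟨s, hs⟩ := hKfg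
  obtain ⟨p, hp⟩ := exists_common_fixed_point (s.image r)
    (by intro S hS T hT
        obtain ⟨a, -, rfl⟩ := Finset.mem_image.1 hS
        obtain ⟨b, -, rfl⟩ := Finset.mem_image.1 hT
        exact hcomm a b)
    (by intro S hS
        obtain ⟨a, ha, rfl⟩ := Finset.mem_image.1 hS
        have : a ∈ K := by rw [← hs]; exact Subgroup.subset_closure ha
        exact this)
  have hpK : ∀ a ∈ K, r a p = p := by
    intro a ha
    rw [← hs] at ha
    induction ha using Subgroup.closure_induction with
    | mem a ha => exact hp _ (Finset.mem_image_of_mem r ha)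
    | one => simp
    | mul a b _ _ ha hb => rw [hom_mul_apply, hb, ha]
    | inv a _ ha =>
      conv_lhs => rw [← ha]
      exact hom_inv_apply_apply r a p
  let C : Set ℝ := {x | ∀ a ∈ K, r a x = x}
  have hCclosed : IsClosed C := by
    have : C = ⋂ a ∈ K, {x | r a x = x} := by ext x; simp [C]
    rw [this]
    exact isClosed_biInter fun a _ => isClosed_eq (r a).continuous continuous_id
  have hCinv : ∀ a, ∀ x ∈ C, r a x ∈ C := by
    intro a x hx b hb
    rw [hom_apply_comm, hx b hb]
  have hCiff : ∀ a x, x ∈ C ↔ r a x ∈ C := by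
    refine fun a x => ⟨hCinv a x, fun h => ?_⟩
    rw [← hom_inv_apply_apply r a x]
    exact hCinv _ _ h
  -- `K` contains a nontrivial element and the action is faithful. Hence `C` is countable and has an
  -- isolated point.
  have hCne : C ≠ Set.univ := by
    intro hcon
    obtain ⟨a, ha1, ha⟩ := hk
    refine ha1 (hinj ?_)
    rw [map_one]
    ext x
    have : x ∈ C := hcon ▸ Set.mem_univ x
    exact this a ha
  have hpC : C.Nonempty := ⟨p, hpK⟩
  obtain ⟨c, hcC, ε, hε, hc⟩ := exists_isolated hCclosed
    (hr.countable_of_isClosed hCclosed hCinv hCne) hpC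
  -- An extremum of `C` would be a global fixed point. Therefore `c` has neighbours `b < c < d` in
  -- `C`.
  have hunb : ¬ BddAbove C := by
    intro hb
    obtain ⟨a, ha⟩ := hr.not_fixed (sSup C)
    exact ha (apply_csSup_eq (r a) hpC hb (hCiff a))
  have hunb' : ¬ BddBelow C := by
    intro hb
    obtain ⟨a, ha⟩ := hr.not_fixed (sInf C)
    exact ha (apply_csInf_eq (r a) hpC hb (hCiff a))
  have hne1 : (C ∩ Set.Ici (c + ε)).Nonempty := by
    rw [not_bddAbove_iff] at hunb
    obtain ⟨y, hy, hy'⟩ := hunb (c + ε)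
    exact ⟨y, hy, hy'.le⟩
  have hne2 : (C ∩ Set.Iic (c - ε)).Nonempty := by
    rw [not_bddBelow_iff] at hunb'
    obtain ⟨y, hy, hy'⟩ := hunb' (c - ε)
    exact ⟨y, hy, hy'.le⟩
  have hb1 : BddBelow (C ∩ Set.Ici (c + ε)) := ⟨c + ε, fun y hy => hy.2⟩
  have hb2 : BddAbove (C ∩ Set.Iic (c - ε)) := ⟨c - ε, fun y hy => hy.2⟩
  set d := sInf (C ∩ Set.Ici (c + ε)) with hd
  set b := sSup (C ∩ Set.Iic (c - ε)) with hb
  have hdC : d ∈ C ∩ Set.Ici (c + ε) := (hCclosed.inter isClosed_Ici).csInf_mem hne1 hb1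
  have hbC : b ∈ C ∩ Set.Iic (c - ε) := (hCclosed.inter isClosed_Iic).csSup_mem hne2 hb2
  have hcd : c < d := by have := hdC.2; simp only [Set.mem_Ici] at this; linarith
  have hbc : b < c := by have := hbC.2; simp only [Set.mem_Iic] at this; linarith
  have gap1 : ∀ y ∈ C, c < y → d ≤ y := by
    intro y hy hcy
    by_cases h : c + ε ≤ y
    · exact csInf_le hb1 ⟨hy, h⟩
    · exact absurd (hc y hy (by rw [abs_lt]; constructor <;> linarith)) hcy.ne'
  have gap2 : ∀ y ∈ C, y < c → y ≤ b := by
    intro y hy hcy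
    by_cases h : y ≤ c - ε
    · exact le_csSup hb2 ⟨hy, h⟩
    · exact absurd (hc y hy (by rw [abs_lt]; constructor <;> linarith)) hcy.ne
  -- An element that preserves `C` and carries a point of the gap `(b, c)` into the gap `(c, d)`
  -- must carry `c` to `d`.
  obtain ⟨t, -, x, hx, hy⟩ := hr.lineTransitive (Set.Ioo b c) (Set.Ioo c d) isOpen_Ioo
    (Set.nonempty_Ioo.2 hbc) isOpen_Ioo (Set.nonempty_Ioo.2 hcd)
  have htc : r t c = d := by
    have h1 : d ≤ r t c := gap1 _ (hCinv t c hcC) (hy.1.trans ((r t).strictMono hx.2))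
    have h2 : r t⁻¹ d ∈ C := hCinv _ _ hdC.1
    have h3 : x < r t⁻¹ d := by
      apply lt_of_apply_lt (r t); rw [hom_apply_inv_apply]; exact hy.2
    have h4 : c ≤ r t⁻¹ d := by
      by_contra hcon
      have := gap2 _ h2 (not_le.1 hcon)
      exact absurd (hx.1.trans h3) (not_lt.2 this)
    have h5 := (r t).monotone h4
    rw [hom_apply_inv_apply] at h5
    exact le_antisymm h5 h1
  -- A fixed point would put `t` into `K`, which fixes `c`.
  have htfix : ∀ x, r t x ≠ x := by
    intro x hx
    have := hcC t ⟨x, hx⟩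
    rw [htc] at this
    exact hcd.ne' this
  refine ⟨t, c, htc ▸ hcd, htfix, fun a => ?_⟩
  obtain ⟨m, h1, h2⟩ := exists_zpow_le_lt htfix (htc ▸ hcd : c < r t c) (r a c)
  refine ⟨m, ?_⟩
  -- The point `t ^ (-m) a c` lies in `C ∩ [c, d)`, which contains only `c`.
  have h3 : c ≤ r (t ^ (-m) * a) c := by
    rw [hom_mul_apply, map_zpow]
    have := (r t ^ (-m)).monotone h1
    rwa [zpow_neg_apply_apply] at this
  have h4 : r (t ^ (-m) * a) c < d := by
    rw [hom_mul_apply, map_zpow, ← htc]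
    have := (r t ^ (-m)).strictMono h2
    rwa [zpow_add_apply, zpow_neg_apply_apply, zpow_one] at this
  have h5 : r (t ^ (-m) * a) c = c := by
    by_contra hcon
    exact absurd (gap1 _ (hCinv _ _ hcC) (lt_of_le_of_ne h3 (Ne.symm hcon))) (not_le.2 h4)
  rw [hom_mul_apply, map_zpow] at h5
  rw [← zpow_apply_neg_apply (r t) m (r a c), h5]

end

/-! ### Free actions on the line -/

/-- An order isomorphism between dense subsets of the line extends to the line. -/
theorem exists_orderIso_extension {ι : Type} [Nonempty ι] (D τ : ι → ℝ) (hD : DenseRange D)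
    (hτ : DenseRange τ) (h : ∀ a b, D a < D b ↔ τ a < τ b) :
    ∃ ψ : HomeoPlusLine, ∀ a, ψ (D a) = τ a := by
  -- The image of `x` is the supremum of the values `τ a` over the Dedekind cut `D a < x`. Density
  -- of both ranges makes the cut correspondence exact, strict inequalities included.
  have key : ∀ D τ : ι → ℝ, DenseRange D → DenseRange τ → (∀ a b, D a < D b ↔ τ a < τ b) →
      ∀ x, ∃ y, ∀ a, τ a < y ↔ D a < x := by
    intro D τ hD _ h x
    obtain ⟨_, ⟨u, rfl⟩, hu⟩ := hD.exists_gt x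
    obtain ⟨_, ⟨l, rfl⟩, hl⟩ := hD.exists_lt x
    have hle : ∀ a b, D a < x → x ≤ D b → τ a < τ b :=
      fun a b ha hb => (h a b).1 (lt_of_lt_of_le ha hb)
    have hne : (τ '' {a | D a < x}).Nonempty := ⟨_, l, hl, rfl⟩
    have hb : BddAbove (τ '' {a | D a < x}) :=
      ⟨τ u, by rintro _ ⟨a, ha, rfl⟩; exact (hle a u ha (le_of_lt hu)).le⟩
    refine ⟨sSup (τ '' {a | D a < x}), fun a => ⟨fun ha => ?_, fun ha => ?_⟩⟩
    · by_contra hcon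
      refine absurd ha (not_lt.2 (csSup_le hne ?_))
      rintro _ ⟨b, hb, rfl⟩
      exact (hle b a hb (not_lt.1 hcon)).le
    · obtain ⟨_, ⟨b, rfl⟩, hb'⟩ := hD.exists_between ha
      exact lt_of_lt_of_le ((h a b).1 hb'.1) (le_csSup hb ⟨b, hb'.2, rfl⟩)
  have cut : ∀ D : ι → ℝ, DenseRange D → ∀ x y, (∀ a, D a < x ↔ D a < y) → x ≤ y := by
    intro D hD x y hxy
    by_contra hcon
    obtain ⟨_, ⟨b, rfl⟩, hb⟩ := hD.exists_between (not_le.1 hcon)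
    exact lt_asymm ((hxy b).1 hb.2) hb.1
  have cut' : ∀ D : ι → ℝ, DenseRange D → ∀ x y, (∀ a, D a < x ↔ D a < y) → x = y :=
    fun D hD x y hxy => le_antisymm (cut D hD x y hxy) (cut D hD y x fun a => (hxy a).symm)
  choose f hf using key D τ hD hτ h
  choose g hg using key τ D hτ hD fun a b => (h a b).symm
  have hfm : StrictMono f := by
    intro x y hxy
    obtain ⟨_, ⟨b, rfl⟩, hb⟩ := hD.exists_between hxy
    have h1 := (hf y b).2 hb.2
    refine lt_of_le_of_lt (not_lt.1 fun hcon => ?_) h1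
    exact lt_asymm ((hf x b).1 hcon) hb.1
  refine ⟨hfm.orderIsoOfRightInverse f g fun y => cut' τ hτ _ _ fun a => ?_,
    fun a => cut' τ hτ _ _ fun b => ?_⟩
  · rw [hf, hg]
  · change τ b < f (D a) ↔ _
    rw [hf, h]

section

variable {A : Type} [CommGroup A] {r : A →* HomeoPlusLine}

/-- Hölder's theorem: a free almost minimal action on the line is conjugate to an action by
translations. -/
theorem LineAlmostMinimal.exists_conj_translation (hr : LineAlmostMinimal r)
    (hfree : ∀ a x, r a x = x → a = 1) :
    ∃ (ψ : HomeoPlusLine) (τ : Additive A →+ ℝ), Function.Injective τ ∧ DenseRange τ ∧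
      ∀ a x, ψ (r a x) = ψ x + τ (Additive.ofMul a) := by
  obtain ⟨x₀, -, hd⟩ := hr.exists_mem_dense isOpen_univ Set.univ_nonempty
  have hDinj : Function.Injective (fun a : Additive A => r a.toMul x₀) := by
    intro a b hab
    have h1 : r (b.toMul⁻¹ * a.toMul) x₀ = x₀ := by
      rw [hom_mul_apply]
      simp only at hab
      rw [hab, hom_inv_apply_apply]
    have h2 := hfree _ _ h1
    rw [inv_mul_eq_one] at h2
    exact congrArg Additive.ofMul h2.symm
  -- By freeness the orbit map at `x₀` is injective, so the order of the line pulls back to an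
  -- invariant order on the group. It is archimedean because the powers of an element without fixed
  -- points pass every point.
  let _ : LinearOrder (Additive A) := LinearOrder.lift' (fun a : Additive A => r a.toMul x₀) hDinj
  have hlt : ∀ a b : Additive A, a < b ↔ r a.toMul x₀ < r b.toMul x₀ := fun a b => Iff.rfl
  have hle : ∀ a b : Additive A, a ≤ b ↔ r a.toMul x₀ ≤ r b.toMul x₀ := fun a b => Iff.rfl
  have : IsOrderedAddMonoid (Additive A) :=
    { add_le_add_left := by
        intro a b hab c
        rw [hle] at hab ⊢
        rw [add_comm a, add_comm b, toMul_add, toMul_add, hom_mul_apply, hom_mul_apply]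
        exact (r c.toMul).monotone hab }
  have : Archimedean (Additive A) := by
    refine ⟨fun a b hb => ?_⟩
    rw [hlt, toMul_zero, map_one] at hb
    have hfix : ∀ x, r b.toMul x ≠ x := by
      intro x hx
      have := hfree _ _ hx
      rw [this, map_one] at hb
      exact lt_irrefl _ hb
    obtain ⟨m, -, hm⟩ := exists_zpow_le_lt hfix hb (r a.toMul x₀)
    refine ⟨(m + 1).toNat, ?_⟩
    rw [hle, toMul_nsmul, map_pow, ← zpow_natCast]
    exact hm.le.trans ((strictMono_zpow_apply hb).monotone (Int.self_le_toNat _))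
  obtain ⟨τ, hτ⟩ := Archimedean.exists_orderAddMonoidHom_real_injective (Additive A)
  have hτm : StrictMono τ := τ.monotone'.strictMono_of_injective hτ
  have hDr : DenseRange (fun a : Additive A => r a.toMul x₀) := hd
  have hτd : DenseRange τ := by
    have h1 : Dense ((τ : Additive A →+ ℝ).range : Set ℝ) := by
      refine AddSubgroup.dense_of_not_isolated_zero _ fun ε hε => ?_
      by_contra! hcon
      have hcon' : ∀ a, 0 < τ a → ε ≤ τ a := by
        intro a ha
        by_contra h'
        exact hcon (τ a) ⟨a, rfl⟩ ⟨ha, not_le.1 h'⟩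
      -- If positive values of `τ` were at least `ε`, density of the orbit would allow splitting any
      -- positive `a` as `(a - b) + b` with both parts positive. Iterating makes `τ a` exceed every
      -- multiple of `ε`.
      have half : ∀ n : ℕ, ∀ a, 0 < τ a → n * ε ≤ τ a := by
        intro n
        induction n with
        | zero => intro a ha; simpa using ha.le
        | succ n ih =>
          intro a ha
          have ha' : (0 : Additive A) < a := by
            rw [← hτm.lt_iff_lt, map_zero]; exact ha
          rw [hlt] at ha'
          obtain ⟨_, ⟨b, rfl⟩, hb⟩ := hDr.exists_between ha'
          have h1 : 0 < τ b := by rw [← map_zero τ, hτm.lt_iff_lt, hlt]; exact hb.1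
          have h2 : τ b < τ a := by rw [hτm.lt_iff_lt, hlt]; exact hb.2
          have h3 := ih (a - b) (by rw [map_sub]; linarith)
          have h4 := hcon' b h1
          rw [map_sub] at h3
          push_cast
          linarith
      obtain ⟨_, ⟨b, rfl⟩, hb⟩ := hDr.exists_gt x₀
      have h1 : 0 < τ b := by
        rw [← map_zero τ, hτm.lt_iff_lt, hlt, toMul_zero, map_one]; exact hb
      obtain ⟨n, hn⟩ := exists_nat_gt (τ b / ε)
      rw [div_lt_iff₀ hε] at hn
      exact absurd (half n b h1) (not_le.2 hn)
    exact h1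
  obtain ⟨ψ, hψ⟩ := exists_orderIso_extension (fun a : Additive A => r a.toMul x₀) τ hDr hτd
    fun a b => by rw [hτm.lt_iff_lt, hlt]
  refine ⟨ψ, (τ : Additive A →+ ℝ), hτ, hτd, fun a => ?_⟩
  -- Both sides are continuous and agree on the dense orbit of `x₀`.
  have h1 : (fun x => ψ (r a x)) = fun x => ψ x + τ (Additive.ofMul a) := by
    refine hDr.equalizer (ψ.continuous.comp (r a).continuous)
      (ψ.continuous.add continuous_const) ?_
    funext b
    have h2 := hψ (Additive.ofMul a + b)
    have h3 := hψ b
    rw [toMul_add, toMul_ofMul, hom_mul_apply] at h2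
    simp only [Function.comp]
    rw [h2, h3, map_add, add_comm]
  exact fun x => congrFun h1 x

end

/-! ### Ranks -/

/-- A homeomorphism of the line has no nontrivial finite orbits. -/
theorem apply_eq_of_pow_apply_eq {T : HomeoPlusLine} {n : ℕ} (hn : n ≠ 0) {x : ℝ}
    (h : (T ^ n) x = x) : T x = x := by
  have h1 : (⇑T)^[n] x = (_root_.id)^[n] x := by
    rw [Function.iterate_id, id]
    have : ∀ (m : ℕ) y, (⇑T)^[m] y = (T ^ m) y := by
      intro m
      induction m with
      | zero => intro y; rfl
      | succ m ih => intro y; rw [Function.iterate_succ_apply, ih, pow_succ]; rfl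
    rw [this, h]
  exact ((Function.Commute.id_right (f := ⇑T)).iterate_pos_eq_iff_map_eq T.monotone
    strictMono_id (Nat.pos_of_ne_zero hn)).1 h1

/-- Order automorphisms of the line have no torsion. With finite generation this makes the acting
group free over `ℤ`, so that ranks can be counted. -/
theorem isMulTorsionFree_of_injective {A : Type} [CommGroup A] {r : A →* HomeoPlusLine}
    (hinj : Function.Injective r) : IsMulTorsionFree A := by
  refine ⟨fun n hn a b hab => ?_⟩
  simp only at hab
  have h1 : (a * b⁻¹) ^ n = 1 := by rw [mul_pow, inv_pow, hab, mul_inv_cancel]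
  have h2 : r (a * b⁻¹) = 1 := by
    ext x
    refine apply_eq_of_pow_apply_eq hn ?_
    rw [← map_pow, h1, map_one]
    rfl
  rw [← map_one r] at h2
  exact mul_inv_eq_one.1 (hinj h2)

/-- The group is the direct sum of `K` and the infinite cyclic group of `t`. This serves both for
the stabilizer of a point of a discrete orbit and for the lifts of `ℤⁿ`, where `t` is the deck
transformation. -/
theorem finite_and_finrank_of_split {A K : Type} [CommGroup A] [AddCommGroup K]
    (i : K →+ Additive A) (hi : Function.Injective i) (t : A)
    (h : ∀ a, ∃ (m : ℤ) (κ : K), a = t ^ m * (i κ).toMul)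
    (ht : ∀ (m : ℤ) (κ : K), t ^ m = (i κ).toMul → m = 0) [Module.Free ℤ K]
    [Module.Finite ℤ K] :
    Module.Finite ℤ (Additive A) ∧ Module.finrank ℤ (Additive A) = Module.finrank ℤ K + 1 := by
  let f : (K × ℤ) →ₗ[ℤ] Additive A :=
    (AddMonoidHom.coprod i (zmultiplesHom (Additive A) (Additive.ofMul t))).toIntLinearMap
  have hf : ∀ p, f p = Additive.ofMul ((i p.1).toMul * t ^ p.2) := fun p => rfl
  have hbij : Function.Bijective f := by
    constructor
    · rw [injective_iff_map_eq_zero]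
      rintro ⟨κ, m⟩ hp
      rw [hf] at hp
      have hp : (i κ).toMul * t ^ m = 1 := hp
      have h1 : t ^ m = (i (-κ)).toMul := by
        rw [map_neg, toMul_neg]; exact eq_inv_of_mul_eq_one_right hp
      have h2 := ht _ _ h1
      subst h2
      rw [zpow_zero, mul_one] at hp
      have h3 : i κ = i 0 := by rw [map_zero]; exact congrArg Additive.ofMul hp
      exact Prod.ext (hi h3) rfl
    · intro a
      obtain ⟨m, κ, h⟩ := h a.toMul
      refine ⟨(κ, m), ?_⟩
      rw [hf, mul_comm]
      exact congrArg Additive.ofMul h.symm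
  let e := LinearEquiv.ofBijective f hbij
  refine ⟨Module.Finite.equiv e, ?_⟩
  rw [← e.finrank_eq, Module.finrank_prod, Module.finrank_self]

/-! ### Restriction to an interval between consecutive points of a discrete orbit -/

section

variable {A : Type} [CommGroup A]

/-- The stabilizer of a point of the line. -/
def pointStabilizer (r : A →* HomeoPlusLine) (c : ℝ) : Subgroup A where
  carrier := {a | r a c = c}
  one_mem' := by simp
  mul_mem' := by
    intro a b ha hb
    change r (a * b) c = c
    rw [hom_mul_apply, show r b c = c from hb, show r a c = c from ha]
  inv_mem' := by
    intro a ha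
    change r a⁻¹ c = c
    conv_lhs => rw [← show r a c = c from ha]
    exact hom_inv_apply_apply r a c

/-- The orbit of `c` under `r` is the orbit of `c` under the homeomorphism `r t`, which moves every
point and moves `c` to the right. -/
structure IsDiscreteOrbit (r : A →* HomeoPlusLine) (t : A) (c : ℝ) : Prop where
  lt : c < r t c
  ne : ∀ x, r t x ≠ x
  orbit : ∀ a, ∃ m : ℤ, r a c = (r t ^ m) c

variable {r : A →* HomeoPlusLine} {t : A} {c : ℝ}

theorem pointStabilizer_apply (κ : pointStabilizer r c) : r κ c = c := κ.2

theorem pointStabilizer_apply_mem_Ioo (κ : pointStabilizer r c) {x : ℝ}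
    (hx : x ∈ Set.Ioo c (r t c)) : r κ x ∈ Set.Ioo c (r t c) := by
  have h1 := (r κ).strictMono hx.1
  have h2 := (r κ).strictMono hx.2
  rw [hom_apply_comm, pointStabilizer_apply] at h2
  rw [pointStabilizer_apply] at h1
  exact ⟨h1, h2⟩

/-- The stabilizer of `c` acts on the interval `(c, t c)` and hence on the line. -/
theorem exists_restrict_pointStabilizer (P : ℝ ≃ₜ Set.Ioo c (r t c)) :
    ∃ r' : pointStabilizer r c →* HomeoPlusLine, ∀ κ x, (P (r' κ x) : ℝ) = r κ (P x) := by
  have hm : StrictMono (fun t => (P t : ℝ)) ∨ StrictAnti (fun t => (P t : ℝ)) :=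
    Continuous.strictMono_of_inj (continuous_subtype_val.comp P.continuous)
      (Subtype.val_injective.comp P.injective)
  -- Conjugation by `P` preserves monotonicity even when `P` is decreasing; `P` is built from `h`,
  -- whose orientation is arbitrary.
  let f : pointStabilizer r c → ℝ → ℝ := fun κ x =>
    P.symm ⟨r κ (P x), pointStabilizer_apply_mem_Ioo κ (P x).2⟩
  have hf : ∀ κ x, (P (f κ x) : ℝ) = r κ (P x) := fun κ x => by simp [f]
  have hPinj : ∀ x y, (P x : ℝ) = P y → x = y := fun x y h => P.injective (Subtype.ext h)
  have hfm : ∀ κ, StrictMono (f κ) := by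
    intro κ x y hxy
    rcases hm with hm | hm
    · rw [← hm.lt_iff_lt]
      simp only [hf]
      exact (r κ).strictMono (hm hxy)
    · rw [← hm.lt_iff_gt]
      simp only [hf]
      exact (r κ).strictMono (hm hxy)
  have hinv : ∀ κ, Function.RightInverse (f κ⁻¹) (f κ) := by
    intro κ x
    apply hPinj
    rw [hf, hf, Subgroup.coe_inv, hom_apply_inv_apply]
  refine ⟨MonoidHom.mk' (fun κ => (hfm κ).orderIsoOfRightInverse _ _ (hinv κ)) fun κ ι => ?_,
    hf⟩
  ext x
  apply hPinj
  change (P (f (κ * ι) x) : ℝ) = P (f κ (f ι x))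
  rw [hf, hf, hf, Subgroup.coe_mul, hom_mul_apply]

/-! ### What the stabilizer action on `(c, t c)` inherits -/

namespace IsDiscreteOrbit

theorem exists_eq_zpow_mul (H : IsDiscreteOrbit r t c) (a : A) :
    ∃ (m : ℤ) (κ : pointStabilizer r c), a = t ^ m * κ := by
  obtain ⟨m, hm⟩ := H.orbit a
  refine ⟨m, ⟨t ^ (-m) * a, ?_⟩, by simp⟩
  change r _ c = c
  rw [hom_mul_apply, map_zpow, hm, zpow_neg_apply_apply]

theorem zpow_apply_eq_iff (H : IsDiscreteOrbit r t c) {m n : ℤ} :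
    (r t ^ m) c = (r t ^ n) c ↔ m = n :=
  (strictMono_zpow_apply H.lt).injective.eq_iff

theorem zpow_mem_iff (H : IsDiscreteOrbit r t c) {m : ℤ} :
    t ^ m ∈ pointStabilizer r c ↔ m = 0 := by
  rw [← H.zpow_apply_eq_iff, ← map_zpow]
  exact Iff.rfl

/-- Since `a c = t ^ m c`, the image of `(c, t c)` under `a` is the `m`-th interval between orbit
points, which meets the original one only for `m = 0`. -/
theorem mem_pointStabilizer (H : IsDiscreteOrbit r t c) {a : A} {x : ℝ}
    (hx : x ∈ Set.Ioo c (r t c)) (hax : r a x ∈ Set.Ioo c (r t c)) :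
    a ∈ pointStabilizer r c := by
  obtain ⟨m, hm⟩ := H.orbit a
  have hsm := strictMono_zpow_apply H.lt
  have h1 : (r t ^ m) c < (r t ^ (1 : ℤ)) c := by
    rw [← hm, zpow_one]
    exact ((r a).strictMono hx.1).trans hax.2
  have h2 : (r t ^ (0 : ℤ)) c < (r t ^ (m + 1)) c := by
    rw [add_comm, zpow_add_apply, ← hm, zpow_one, ← hom_apply_comm]
    exact lt_trans hax.1 ((r a).strictMono hx.2)
  have h1 := hsm.lt_iff_lt.1 h1
  have h2 := hsm.lt_iff_lt.1 h2
  obtain rfl : m = 0 := by omega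
  exact hm

/-- An element of the stabilizer that is trivial on `(c, t c)` is trivial on all translates by
powers of `t`, with which it commutes. These and the orbit of `c` cover the line. -/
theorem restrict_injective (H : IsDiscreteOrbit r t c) (hinj : Function.Injective r)
    {P : ℝ ≃ₜ Set.Ioo c (r t c)}
    {r' : pointStabilizer r c →* HomeoPlusLine} (hr' : ∀ κ x, (P (r' κ x) : ℝ) = r κ (P x)) :
    Function.Injective r' := by
  rw [injective_iff_map_eq_one]
  intro κ hκ
  apply Subtype.ext
  apply hinj
  rw [Subgroup.coe_one, map_one]
  ext x
  obtain ⟨m, h1, h2⟩ := exists_zpow_le_lt H.ne H.lt x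
  have h3 : r κ ((r t ^ (-m)) x) = (r t ^ (-m)) x := by
    have h1' := (r t ^ (-m)).monotone h1
    have h2' := (r t ^ (-m)).strictMono h2
    rw [zpow_neg_apply_apply] at h1'
    rw [zpow_add_apply, zpow_neg_apply_apply, zpow_one] at h2'
    rcases eq_or_lt_of_le h1' with h | h
    · rw [← h, pointStabilizer_apply]
    · have h4 := hr' κ (P.symm ⟨_, h, h2'⟩)
      rw [hκ] at h4
      simpa using h4.symm
  rw [← map_zpow, hom_apply_comm] at h3
  exact (r (t ^ (-m))).injective h3

theorem isOpen_image (P : ℝ ≃ₜ Set.Ioo c (r t c)) {U : Set ℝ} (hU : IsOpen U) :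
    IsOpen ((fun x => (P x : ℝ)) '' U) :=
  (isOpen_Ioo.isOpenMap_subtype_val.comp P.isOpenMap) U hU

/-- An orbit visits `(c, t c)` from inside it only through elements of the stabilizer, so dense
orbits restrict to dense orbits. -/
theorem restrict_almostMinimal (H : IsDiscreteOrbit r t c) (hr : LineAlmostMinimal r)
    {P : ℝ ≃ₜ Set.Ioo c (r t c)}
    {r' : pointStabilizer r c →* HomeoPlusLine} (hr' : ∀ κ x, (P (r' κ x) : ℝ) = r κ (P x)) :
    LineAlmostMinimal r' := by
  have hPinj : Function.Injective (fun x => (P x : ℝ)) := Subtype.val_injective.comp P.injective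
  refine Set.Countable.mono (s₂ := (fun x => (P x : ℝ)) ⁻¹'
    {x | ¬ Dense (Set.range fun a => r a x)}) ?_ (Set.Countable.preimage hr hPinj)
  intro x hx hd
  apply hx
  rw [dense_iff_inter_open]
  intro V hV hV'
  obtain ⟨_, ⟨y, hy, hy'⟩, a, ha⟩ := hd.inter_open_nonempty _ (isOpen_image P hV) (hV'.image _)
  simp only at ha hy'
  have hax : r a (P x) ∈ Set.Ioo c (r t c) := by rw [ha, ← hy']; exact (P y).2
  refine ⟨y, hy, ⟨a, H.mem_pointStabilizer (P x).2 hax⟩, hPinj ?_⟩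
  simp only
  rw [hr', hy', ← ha]

/-- Every nonempty open set meets some translate `t ^ m (c, t c)`, so transitivity on one interval
spreads once `t` is adjoined. -/
theorem lineTransitive_sup (H : IsDiscreteOrbit r t c) {P : ℝ ≃ₜ Set.Ioo c (r t c)}
    {r' : pointStabilizer r c →* HomeoPlusLine} (hr' : ∀ κ x, (P (r' κ x) : ℝ) = r κ (P x))
    {F : Subgroup (pointStabilizer r c)} (hF : LineTransitive r' F) :
    LineTransitive r (F.map (pointStabilizer r c).subtype ⊔ Subgroup.zpowers t) := by
  have pull : ∀ U : Set ℝ, IsOpen U → U.Nonempty → ∃ m : ℤ, ∃ x : ℝ, (r t ^ m) (P x) ∈ U := by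
    rintro U hU ⟨x, hx⟩
    obtain ⟨m, h1, h2⟩ := exists_zpow_le_lt H.ne H.lt x
    have h3 : x ∈ closure (Set.Ioo ((r t ^ m) c) ((r t ^ (m + 1)) c)) := by
      rw [closure_Ioo (strictMono_zpow_apply H.lt (lt_add_one m)).ne]
      exact ⟨h1, h2.le⟩
    obtain ⟨y, hyU, hy1, hy2⟩ := mem_closure_iff.1 h3 U hU hx
    have hy1' := (r t ^ (-m)).strictMono hy1
    have hy2' := (r t ^ (-m)).strictMono hy2
    rw [zpow_neg_apply_apply] at hy1'
    rw [zpow_add_apply, zpow_neg_apply_apply, zpow_one] at hy2'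
    refine ⟨m, P.symm ⟨_, hy1', hy2'⟩, ?_⟩
    simpa [zpow_apply_neg_apply, -zpow_neg] using hyU
  intro U V hU hU' hV hV'
  obtain ⟨m, x, hx⟩ := pull U hU hU'
  obtain ⟨l, y, hy⟩ := pull V hV hV'
  have hcont : ∀ m : ℤ, Continuous fun x => (r t ^ m) (P x) := fun m =>
    (r t ^ m).continuous.comp (continuous_subtype_val.comp P.continuous)
  obtain ⟨κ, hκ, z, hz, hz'⟩ := hF _ _ (hU.preimage (hcont m)) ⟨x, hx⟩
    (hV.preimage (hcont l)) ⟨y, hy⟩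
  have ht : ∀ m : ℤ, t ^ m ∈ F.map (pointStabilizer r c).subtype ⊔ Subgroup.zpowers t :=
    fun m => (le_sup_right : Subgroup.zpowers t ≤ _) (Subgroup.zpow_mem_zpowers t m)
  refine ⟨t ^ l * κ * t ^ (-m), mul_mem (mul_mem (ht l) ?_) (ht (-m)), _, hz, ?_⟩
  · exact (le_sup_left : F.map _ ≤ _) ⟨κ, hκ, rfl⟩
  · rw [hom_mul_apply, map_zpow, zpow_neg_apply_apply, hom_mul_apply, ← hr', map_zpow]
    exact hz'

/-- A transitive `F` of infinite index in the stabilizer with `κ ∈ F` would give the transitive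
subgroup `F ⟨t⟩`, which contains `t ^ m * κ` and still has infinite index because it meets the
stabilizer in `F` only. -/
theorem restrict_tightAt (H : IsDiscreteOrbit r t c) {P : ℝ ≃ₜ Set.Ioo c (r t c)}
    {r' : pointStabilizer r c →* HomeoPlusLine} (hr' : ∀ κ x, (P (r' κ x) : ℝ) = r κ (P x))
    {m : ℤ} {κ : pointStabilizer r c} (hg : TightAt r (t ^ m * κ)) : TightAt r' κ := by
  intro F hκ hF htrans
  refine hg _ ?_ ?_ (H.lineTransitive_sup hr' htrans)
  · rw [mul_comm]
    exact Subgroup.mul_mem_sup ⟨κ, hκ, rfl⟩ (Subgroup.zpow_mem_zpowers t m)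
  · have h1 : (F.map (pointStabilizer r c).subtype ⊔ Subgroup.zpowers t) ⊓ pointStabilizer r c =
        F.map (pointStabilizer r c).subtype := by
      apply le_antisymm
      · rintro a ⟨ha, ha'⟩
        obtain ⟨_, ⟨b, hb, rfl⟩, _, ⟨l, rfl⟩, rfl⟩ := Subgroup.mem_sup.1 ha
        have h2 := mul_mem (inv_mem b.2) ha'
        simp only [Subgroup.subtype_apply, inv_mul_cancel_left] at h2
        rw [H.zpow_mem_iff] at h2
        subst h2
        exact ⟨b, hb, by simp⟩
      · refine le_inf le_sup_left ?_
        rintro _ ⟨b, -, rfl⟩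
        exact b.2
    rw [← Subgroup.relIndex_top_right]
    refine Subgroup.relIndex_eq_zero_of_le_right (le_top : pointStabilizer r c ≤ ⊤) ?_
    rw [← Subgroup.inf_relIndex_right, h1, Subgroup.relIndex, Subgroup.subgroupOf,
      Subgroup.comap_map_eq_self_of_injective (Subgroup.subtype_injective _)]
    exact hF

theorem finrank_pointStabilizer_add_one (H : IsDiscreteOrbit r t c)
    (hinj : Function.Injective r) [Module.Finite ℤ (Additive A)] :
    Module.Finite ℤ (Additive (pointStabilizer r c)) ∧
    Module.finrank ℤ (Additive (pointStabilizer r c)) + 1 = Module.finrank ℤ (Additive A) := by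
  have h1 : Module.Finite ℤ (Additive (pointStabilizer r c)) :=
    inferInstanceAs (Module.Finite ℤ
      (AddSubgroup.toIntSubmodule (Subgroup.toAddSubgroup (pointStabilizer r c))))
  have := isMulTorsionFree_of_injective hinj
  have h2 : Module.IsTorsionFree ℤ (Additive (pointStabilizer r c)) := inferInstance
  have h3 : Module.Free ℤ (Additive (pointStabilizer r c)) :=
    Module.free_of_finite_type_torsion_free'
  refine ⟨h1, (finite_and_finrank_of_split
    (MonoidHom.toAdditive (pointStabilizer r c).subtype)
    (pointStabilizer r c).subtype_injective t H.exists_eq_zpow_mul fun m κ h => ?_).2.symm⟩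
  rw [← H.zpow_mem_iff, h]
  exact κ.toMul.2

end IsDiscreteOrbit

end

/-! ### Actions by translations -/

section

variable {A : Type} [CommGroup A] {r : A →* HomeoPlusLine}

/-- The image of a group of rank at most one consists of multiples of a single real number and is
not dense. -/
theorem two_le_finrank_of_denseRange {M : Type} [AddCommGroup M] [Module.Finite ℤ M]
    [Module.Free ℤ M] {τ : M →+ ℝ} (hτ : DenseRange τ) : 2 ≤ Module.finrank ℤ M := by
  by_contra hcon
  obtain ⟨v, hv⟩ := finrank_le_one_iff.1 (show Module.finrank ℤ M ≤ 1 by omega)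
  have hrange : ∀ w, ∃ m : ℤ, τ w = m * τ v := by
    intro w
    obtain ⟨m, rfl⟩ := hv w
    exact ⟨m, by simp⟩
  have hpos : 0 < |τ v| := by
    rw [abs_pos]
    intro h0
    obtain ⟨_, ⟨w, rfl⟩, hw⟩ := hτ.exists_gt 0
    obtain ⟨m, hm⟩ := hrange w
    rw [hm, h0, mul_zero] at hw
    exact lt_irrefl _ hw
  obtain ⟨_, ⟨w, rfl⟩, hw1, hw2⟩ := hτ.exists_between hpos
  obtain ⟨m, hm⟩ := hrange w
  rw [← abs_of_pos hw1, hm, abs_mul] at hw2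
  have h1 : (|(m : ℝ)|) < 1 := by
    by_contra h
    nlinarith [not_lt.1 h]
  have h2 : |m| < 1 := by exact_mod_cast h1
  rw [Int.abs_lt_one_iff] at h2
  rw [hm, h2] at hw1
  simp at hw1

theorem exists_irrational_ratio {M : Type} [AddCommGroup M] [Module.Finite ℤ M]
    [Module.Free ℤ M] {τ : M →+ ℝ} (hτ : Function.Injective τ) (hM : 2 ≤ Module.finrank ℤ M)
    {x : M} (hx : x ≠ 0) : ∃ y, Irrational (τ x / τ y) := by
  have hx' : τ x ≠ 0 := fun h => hx (hτ (by rw [h, map_zero]))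
  by_contra! hcon
  -- If all ratios are rational, every value is commensurable with `τ x`; the case `τ y = 0`, where
  -- the quotient is `0` by convention, is covered by `m = 0`. Two basis vectors would then satisfy
  -- a linear relation.
  have hq : ∀ y, ∃ m d : ℤ, d ≠ 0 ∧ d * τ y = m * τ x := by
    intro y
    have h1 := hcon y
    rw [irrational_iff_ne_rational] at h1
    push Not at h1
    obtain ⟨a, b, hb, hab⟩ := h1
    by_cases hy : τ y = 0
    · exact ⟨0, 1, one_ne_zero, by simp [hy]⟩
    · have hb' : (b : ℝ) ≠ 0 := by exact_mod_cast hb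
      refine ⟨b, a, ?_, ?_⟩
      · rintro rfl
        simp [hx', hy] at hab
      · field_simp at hab
        linarith
  let b := Module.finBasis ℤ M
  let i : Fin (Module.finrank ℤ M) := ⟨0, by omega⟩
  let j : Fin (Module.finrank ℤ M) := ⟨1, by omega⟩
  have hij : i ≠ j := by simp [i, j]
  obtain ⟨m, d, hd, hmd⟩ := hq (b i)
  obtain ⟨m', d', hd', hmd'⟩ := hq (b j)
  have h1 : (m' * d) • b i = (m * d') • b j := by
    apply hτ
    rw [map_zsmul, map_zsmul, zsmul_eq_mul, zsmul_eq_mul]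
    push_cast
    linear_combination (m' : ℝ) * hmd - (m : ℝ) * hmd'
  have h2 := congrArg (b.coord i) h1
  simp [hij.symm, hd] at h2
  rw [h2] at hmd'
  have h3 : τ (b j) = 0 := by simpa [hd'] using hmd'
  exact b.ne_zero j (hτ (by rw [h3, map_zero]))

theorem dense_image_closure_pair {M : Type} [AddCommGroup M] (τ : M →+ ℝ) {x y : M}
    (hxy : Irrational (τ x / τ y)) : Dense (τ '' (AddSubgroup.closure {x, y} : Set M)) := by
  have h := dense_addSubgroupClosure_pair_iff.2 hxy
  rwa [← Set.image_pair, ← AddMonoidHom.map_closure] at h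

theorem lineTransitive_of_dense {ψ : HomeoPlusLine} {τ : Additive A →+ ℝ}
    (hψ : ∀ a x, ψ (r a x) = ψ x + τ (Additive.ofMul a)) {F : Subgroup A}
    (hF : Dense ((fun a => τ (Additive.ofMul a)) '' (F : Set A))) : LineTransitive r F := by
  rintro U V - ⟨x, hx⟩ hV ⟨y, hy⟩
  have hc : Continuous fun s : ℝ => ψ.symm (ψ x + s) :=
    ψ.symm.continuous.comp (continuous_const.add continuous_id)
  obtain ⟨_, hs, ⟨a, ha, rfl⟩⟩ := hF.inter_open_nonempty _ (hV.preimage hc)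
    ⟨ψ y - ψ x, by simpa using hy⟩
  refine ⟨a, ha, x, hx, ?_⟩
  simp only [Set.mem_preimage, ← hψ, OrderIso.symm_apply_apply] at hs
  exact hs

/-- The quotient by a subgroup of finite index is torsion, hence of rank zero, so the rank is that
of the subgroup. -/
theorem finrank_le_two_of_index_ne_zero [Module.Finite ℤ (Additive A)] {x y : Additive A}
    (h : (AddSubgroup.closure {x, y}).index ≠ 0) : Module.finrank ℤ (Additive A) ≤ 2 := by
  classical
  let N := Submodule.span ℤ (({x, y} : Finset (Additive A)) : Set (Additive A))
  have hN : N.toAddSubgroup = AddSubgroup.closure {x, y} := by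
    rw [← Submodule.span_int_eq_addSubgroupClosure]
    simp [N]
  have h1 : Module.finrank ℤ N ≤ 2 :=
    (finrank_span_finset_le_card (R := ℤ) {x, y}).trans Finset.card_le_two
  have h2 : Module.finrank ℤ (Additive A ⧸ N) = 0 := by
    rw [Module.finrank_eq_zero_iff_isTorsion]
    intro z
    obtain ⟨z, rfl⟩ := N.mkQ_surjective z
    refine ⟨⟨((AddSubgroup.closure {x, y}).index : ℤ), ?_⟩, ?_⟩
    · rw [mem_nonZeroDivisors_iff_ne_zero]
      exact_mod_cast h
    · change ((AddSubgroup.closure {x, y}).index : ℤ) • N.mkQ z = 0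
      rw [← map_smul, Submodule.mkQ_apply, Submodule.Quotient.mk_eq_zero, natCast_zsmul,
        ← Submodule.mem_toAddSubgroup, hN]
      exact AddSubgroup.nsmul_index_mem _ z
  rw [← Submodule.finrank_quotient_add_finrank N, h2]
  omega

/-- Choose `y` with `τ g / τ y` irrational. The subgroup generated by `g` and `y` has dense image,
so it is transitive; as it contains `g`, tightness gives it finite index. -/
theorem TightAt.finrank_eq_two [Module.Finite ℤ (Additive A)] [Module.Free ℤ (Additive A)]
    {ψ : HomeoPlusLine} {τ : Additive A →+ ℝ} (hτ : Function.Injective τ) (hτd : DenseRange τ)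
    (hψ : ∀ a x, ψ (r a x) = ψ x + τ (Additive.ofMul a)) {g : A} (hg : TightAt r g) :
    Module.finrank ℤ (Additive A) = 2 := by
  have h2 := two_le_finrank_of_denseRange hτd
  have hx : ∃ x : Additive A, x ≠ 0 ∧ ∀ F : AddSubgroup (Additive A), x ∈ F →
      Additive.ofMul g ∈ F := by
    -- For trivial `g` any nonzero `x` takes its place, since every subgroup contains `g`.
    by_cases hg1 : g = 1
    · have : Nontrivial (Additive A) := by
        by_contra hcon
        rw [not_nontrivial_iff_subsingleton] at hcon
        rw [Module.finrank_zero_of_subsingleton] at h2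
        omega
      obtain ⟨x, hx⟩ := exists_ne (0 : Additive A)
      exact ⟨x, hx, fun F _ => by rw [hg1]; exact F.zero_mem⟩
    · exact ⟨Additive.ofMul g, hg1, fun F h => h⟩
  obtain ⟨x, hx, hxg⟩ := hx
  obtain ⟨y, hy⟩ := exists_irrational_ratio hτ h2 hx
  refine le_antisymm (finrank_le_two_of_index_ne_zero (x := x) (y := y) fun h0 => ?_) h2
  refine hg (AddSubgroup.toSubgroup' (AddSubgroup.closure {x, y})) ?_ ?_ ?_
  · exact hxg _ (AddSubgroup.subset_closure (by simp))
  · exact h0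
  · exact lineTransitive_of_dense hψ (dense_image_closure_pair τ hy)

theorem exists_pair_generators {M : Type} [AddCommGroup M] [Module.Finite ℤ M]
    [Module.Free ℤ M] {τ : M →+ ℝ} (hτ : DenseRange τ) (hM : Module.finrank ℤ M = 2) :
    ∃ x y : M, AddSubgroup.closure {x, y} = ⊤ ∧ 0 < τ x ∧ τ x < τ y ∧
      Irrational (τ x / τ y) := by
  let b := Module.finBasisOfFinrankEq ℤ M hM
  have h1 : AddSubgroup.closure {b 0, b 1} = ⊤ := by
    rw [← Submodule.span_int_eq_addSubgroupClosure]
    have h2 : Set.range b = {b 0, b 1} := by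
      ext z
      simp [Fin.exists_fin_two, eq_comm]
    rw [← h2, b.span_eq]
    rfl
  have hirr : ∀ x y, AddSubgroup.closure {x, y} = ⊤ → Irrational (τ x / τ y) := by
    intro x y hxy
    rw [← dense_addSubgroupClosure_pair_iff, ← Set.image_pair, ← AddMonoidHom.map_closure, hxy]
    simpa [DenseRange] using hτ
  have hsign : ∀ x y, AddSubgroup.closure {x, y} = ⊤ →
      ∃ x', AddSubgroup.closure {x', y} = ⊤ ∧ 0 < τ x' := by
    intro x y hxy
    have hx0 : τ x ≠ 0 := by
      intro h0
      have := hirr x y hxy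
      rw [h0, zero_div] at this
      exact this.ne_zero rfl
    rcases lt_or_gt_of_ne hx0 with h | h
    · refine ⟨-x, ?_, by simpa using h⟩
      rw [eq_top_iff, ← hxy, AddSubgroup.closure_le]
      rintro z (rfl | rfl)
      · rw [SetLike.mem_coe, ← neg_mem_iff]
        exact AddSubgroup.subset_closure (by simp)
      · exact AddSubgroup.subset_closure (by simp)
    · exact ⟨x, hxy, h⟩
  -- Changing signs and exchanging the generators arranges `0 < τ x < τ y`, so that the ratio `α`
  -- lies in `(0, 1)`. Equality is excluded because the ratio is irrational.
  obtain ⟨x, hx, hx0⟩ := hsign _ _ h1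
  obtain ⟨y, hy, hy0⟩ := hsign (b 1) x (by rwa [Set.pair_comm])
  rcases lt_trichotomy (τ x) (τ y) with h | h | h
  · rw [Set.pair_comm] at hy
    exact ⟨x, y, hy, hx0, h, hirr x y hy⟩
  · have := hirr y x hy
    rw [h, div_self hy0.ne'] at this
    exact absurd this.ne_one (by simp)
  · exact ⟨y, x, hy, hy0, h, hirr y x hy⟩

/-- A group of translations of rank two with a dense orbit is, up to scaling, `⟨L_1, L_α⟩`. -/
theorem exists_conj_lineGroup_two [Module.Finite ℤ (Additive A)] [Module.Free ℤ (Additive A)]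
    {ψ : HomeoPlusLine} {τ : Additive A →+ ℝ} (hτd : DenseRange τ)
    (hψ : ∀ a x, ψ (r a x) = ψ x + τ (Additive.ofMul a))
    (hA : Module.finrank ℤ (Additive A) = 2) (h : ℝ ≃ₜ Set.Ioo (0 : ℝ) 1) :
    ∃ α : ℝ, Irrational α ∧ α ∈ Set.Ioo (0 : ℝ) 1 ∧ ∃ ψ : HomeoPlusLine,
      r.range.map (MulAut.conj ψ).toMonoidHom = lineGroup h α 2 := by
  obtain ⟨x, y, hxy, hx, hlt, hirr⟩ := exists_pair_generators hτd hA
  have hy : 0 < τ y := hx.trans hlt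
  refine ⟨τ x / τ y, hirr, ⟨div_pos hx hy, (div_lt_one hy).2 hlt⟩,
    ψ.trans (OrderIso.divRight₀ (τ y) hy), ?_⟩
  set Ψ : HomeoPlusLine := ψ.trans (OrderIso.divRight₀ (τ y) hy) with hΨ
  have hΨ' : ∀ z, Ψ z = ψ z / τ y := fun z => rfl
  have hconj : ∀ a : Additive A,
      ((MulAut.conj Ψ).toMonoidHom.comp r) a.toMul = translation (τ a / τ y) := by
    intro a
    change Ψ * r a.toMul * Ψ⁻¹ = _
    rw [mul_inv_eq_iff_eq_mul]
    ext z
    change Ψ (r a.toMul z) = Ψ z + τ a / τ y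
    rw [hΨ', hΨ', hψ, ofMul_toMul, add_div]
  have htop : Subgroup.closure {x.toMul, y.toMul} = (⊤ : Subgroup A) := by
    apply Subgroup.toAddSubgroup.injective
    rw [Subgroup.toAddSubgroup_closure, map_top, ← hxy]
    rfl
  rw [MonoidHom.map_range, MonoidHom.range_eq_map, ← htop, MonoidHom.map_closure,
    Set.image_pair, hconj, hconj, div_self hy.ne', Set.pair_comm]
  rfl

end

/-! ### The line groups -/

/-- Any two bounded open intervals are order isomorphic. -/
theorem exists_orderIso_Ioo {a b c d : ℝ} (hab : a < b) (hcd : c < d) :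
    Nonempty (Set.Ioo a b ≃o Set.Ioo c d) := by
  have key : ∀ {a b c d : ℝ}, a < b → c < d → ∀ x ∈ Set.Ioo a b,
      c + (x - a) / (b - a) * (d - c) ∈ Set.Ioo c d := by
    intro a b c d hab hcd x hx
    have h1 : 0 < (x - a) / (b - a) := div_pos (by linarith [hx.1]) (by linarith)
    have h2 : (x - a) / (b - a) < 1 := by
      rw [div_lt_one (by linarith)]; linarith [hx.2]
    constructor <;> nlinarith
  let f : Set.Ioo a b → Set.Ioo c d := fun x => ⟨_, key hab hcd x x.2⟩
  let g : Set.Ioo c d → Set.Ioo a b := fun x => ⟨_, key hcd hab x x.2⟩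
  have hf : StrictMono f := by
    intro x y hxy
    have hxy' : (x : ℝ) < y := hxy
    change c + ((x : ℝ) - a) / (b - a) * (d - c) < c + ((y : ℝ) - a) / (b - a) * (d - c)
    have h1 : 0 < b - a := by linarith
    have h2 : 0 < d - c := by linarith
    gcongr
  refine ⟨hf.orderIsoOfRightInverse f g fun x => Subtype.ext ?_⟩
  have h1 : b - a ≠ 0 := by linarith
  have h2 : d - c ≠ 0 := by linarith
  change c + ((a + ((x : ℝ) - c) / (d - c) * (b - a)) - a) / (b - a) * (d - c) = x
  field_simp
  ring

theorem LineAlmostMinimal.dichotomy {A : Type} [CommGroup A] {r : A →* HomeoPlusLine}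
    (hr : LineAlmostMinimal r) (hinj : Function.Injective r) [Module.Finite ℤ (Additive A)]
    {g : A} (hg : TightAt r g) :
    (∃ t c, IsDiscreteOrbit r t c) ∨ (Module.finrank ℤ (Additive A) = 2 ∧
      ∀ h : ℝ ≃ₜ Set.Ioo (0 : ℝ) 1, ∃ α : ℝ, Irrational α ∧ α ∈ Set.Ioo (0 : ℝ) 1 ∧
        ∃ ψ : HomeoPlusLine, r.range.map (MulAut.conj ψ).toMonoidHom = lineGroup h α 2) := by
  by_cases hk : ∃ a, a ≠ 1 ∧ ∃ x, r a x = x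
  · obtain ⟨t, c, h1, h2, h3⟩ := hr.exists_discrete_orbit hinj hk
    exact Or.inl ⟨t, c, h1, h2, h3⟩
  · right
    have hfree : ∀ a x, r a x = x → a = 1 := by
      intro a x hx
      by_contra hcon
      exact hk ⟨a, hcon, x, hx⟩
    obtain ⟨ψ, τ, hτ, hτd, hψ⟩ := hr.exists_conj_translation hfree
    have := isMulTorsionFree_of_injective hinj
    have h2 : Module.IsTorsionFree ℤ (Additive A) := inferInstance
    have h3 : Module.Free ℤ (Additive A) := Module.free_of_finite_type_torsion_free'
    have hrank := hg.finrank_eq_two hτ hτd hψ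
    exact ⟨hrank, exists_conj_lineGroup_two hτd hψ hrank⟩

section

variable {A : Type} [CommGroup A] {r : A →* HomeoPlusLine} {t : A} {c : ℝ}

theorem IsDiscreteOrbit.cover (H : IsDiscreteOrbit r t c) (P : ℝ ≃ₜ Set.Ioo c (r t c)) (x : ℝ) :
    ∃ j : ℤ, x = (r t ^ j) c ∨ ∃ s, x = (r t ^ j) (P s) := by
  obtain ⟨m, h1, h2⟩ := exists_zpow_le_lt H.ne H.lt x
  refine ⟨m, ?_⟩
  rcases eq_or_lt_of_le h1 with h | h
  · exact Or.inl h.symm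
  · right
    have h1' := (r t ^ (-m)).strictMono h
    have h2' := (r t ^ (-m)).strictMono h2
    rw [zpow_neg_apply_apply] at h1'
    rw [zpow_add_apply, zpow_neg_apply_apply, zpow_one] at h2'
    exact ⟨P.symm ⟨_, h1', h2'⟩, by simp [zpow_apply_neg_apply, -zpow_neg]⟩

theorem range_zpow_comp (P : ℝ ≃ₜ Set.Ioo c (r t c)) (j : ℤ) :
    Set.range (fun s => (r t ^ j) (P s)) = Set.Ioo ((r t ^ j) c) ((r t ^ (j + 1)) c) := by
  have h1 : Set.range (fun s => (P s : ℝ)) = Set.Ioo c (r t c) := by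
    change Set.range (Subtype.val ∘ P) = _
    rw [Set.range_comp, P.range_coe, Set.image_univ, Subtype.range_coe]
  have h2 : (fun s => (r t ^ j) (P s)) = (r t ^ j) ∘ fun s => (P s : ℝ) := rfl
  rw [h2, Set.range_comp, h1, OrderIso.image_Ioo, zpow_add_apply, zpow_one]

theorem hbar_eq {h : ℝ ≃ₜ Set.Ioo (0 : ℝ) 1} {σ S : HomeoPlusLine} (h1 : ∀ i : ℤ, S i = i)
    (h2 : ∀ (i : ℤ) (x : ℝ), S ((h x : ℝ) + i) = (h (σ x) : ℝ) + i) : hbar h σ = S :=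
  ((existsUnique_hbar h σ).choose_spec.2 S ⟨h1, h2⟩).symm

/-- A conjugacy for the action of the stabilizer on `(c, t c)` extends to one for the whole
action. -/
theorem IsDiscreteOrbit.exists_conj_lineGroup_succ (H : IsDiscreteOrbit r t c)
    {h : ℝ ≃ₜ Set.Ioo (0 : ℝ) 1} (e : Set.Ioo (0 : ℝ) 1 ≃o Set.Ioo c (r t c))
    {r' : pointStabilizer r c →* HomeoPlusLine}
    (hr' : ∀ κ x, (e (h (r' κ x)) : ℝ) = r κ (e (h x))) {α : ℝ} {n : ℕ} {ψ : HomeoPlusLine}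
    (hψ : r'.range.map (MulAut.conj ψ).toMonoidHom = lineGroup h α (n + 2)) :
    ∃ Ψ : HomeoPlusLine, r.range.map (MulAut.conj Ψ).toMonoidHom = lineGroup h α (n + 3) := by
  let P : ℝ ≃ₜ Set.Ioo c (r t c) := h.trans e.toHomeomorph
  have hP : ∀ x, P x = e (h x) := fun x => rfl
  have hm : StrictMono (fun t => (h t : ℝ)) ∨ StrictAnti (fun t => (h t : ℝ)) :=
    Continuous.strictMono_of_inj (continuous_subtype_val.comp h.continuous)
      (Subtype.val_injective.comp h.injective)
  have hrange : ∀ j : ℤ, Set.range (fun s => (h (ψ s) : ℝ) + j) =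
      Set.Ioo (j : ℝ) ((j + 1 : ℤ) : ℝ) := by
    intro j
    have h1 : (fun s => (h (ψ s) : ℝ) + j) = (fun x => x + (j : ℝ)) ∘ Subtype.val ∘ h ∘ ψ := rfl
    rw [h1, Set.range_comp, Set.range_comp, (h.surjective.comp ψ.surjective).range_eq,
      Set.image_univ, Subtype.range_coe, Set.image_add_const_Ioo]
    push_cast
    rw [zero_add, add_comm]
  -- `Ψ` carries the orbit of `c` to `ℤ` and the `j`-th interval to `(j, j + 1)` through `ψ`. The
  -- map `h` enters both parametrizations once, so its orientation cancels in the comparison.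
  obtain ⟨Ψ, hΨ1, hΨ2⟩ := exists_glue_subdivision (fun j => (r t ^ j) c) (fun j => (j : ℝ))
    (strictMono_zpow_apply H.lt) Int.cast_strictMono (exists_zpow_le_lt H.ne H.lt)
    (fun x => ⟨⌊x⌋, Int.floor_le x, by push_cast; exact Int.lt_floor_add_one x⟩)
    (fun j s => (r t ^ j) (P s)) (fun j s => (h (ψ s) : ℝ) + j)
    (fun j s s' => by
      simp only [(r t ^ j).lt_iff_lt, hP, Subtype.coe_lt_coe, e.lt_iff_lt, add_lt_add_iff_right]
      rw [← Subtype.coe_lt_coe, ← Subtype.coe_lt_coe]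
      rcases hm with hm | hm
      · have h1 := hm.lt_iff_lt (a := s) (b := s')
        have h2 := hm.lt_iff_lt (a := ψ s) (b := ψ s')
        rw [h1, h2, ψ.lt_iff_lt]
      · have h1 := hm.lt_iff_gt (a := s) (b := s')
        have h2 := hm.lt_iff_gt (a := ψ s) (b := ψ s')
        rw [h1, h2, ψ.lt_iff_lt])
    (fun j => range_zpow_comp P j) hrange
  have hconj : ∀ S : HomeoPlusLine, ∀ x, (MulAut.conj Ψ) S (Ψ x) = Ψ (S x) := by
    intro S x
    change Ψ (S (Ψ.symm (Ψ x))) = _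
    rw [Ψ.symm_apply_apply]
  have ht : (MulAut.conj Ψ) (r t) = translation 1 := by
    ext y
    obtain ⟨x, rfl⟩ := Ψ.surjective y
    rw [hconj]
    change _ = Ψ x + 1
    obtain ⟨j, rfl | ⟨s, rfl⟩⟩ := H.cover P x
    · rw [← zpow_succ_apply, hΨ1, hΨ1]
      push_cast; ring
    · rw [← zpow_succ_apply, hΨ2, hΨ2]
      push_cast; ring
  -- As `κ` commutes with `t`, it acts on every interval as on the first one, which is what `ħ`
  -- does.
  have hκ : ∀ κ : pointStabilizer r c,
      hbar h ((MulAut.conj ψ) (r' κ)) = (MulAut.conj Ψ) (r κ) := by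
    intro κ
    refine hbar_eq (fun i => ?_) (fun i x => ?_)
    · rw [← hΨ1, hconj, ← map_zpow, hom_apply_comm, pointStabilizer_apply]
    · obtain ⟨s, rfl⟩ := ψ.surjective x
      rw [← hΨ2, hconj, ← map_zpow, hom_apply_comm, hP, ← hr', map_zpow, ← hP, hΨ2]
      change _ = (h (ψ (r' κ (ψ.symm (ψ s)))) : ℝ) + i
      rw [ψ.symm_apply_apply]
  refine ⟨Ψ, ?_⟩
  rw [lineGroup, ← hψ]
  apply le_antisymm
  · rintro _ ⟨_, ⟨a, rfl⟩, rfl⟩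
    obtain ⟨m, κ, rfl⟩ := H.exists_eq_zpow_mul a
    have h1 : (MulAut.conj Ψ) (r (t ^ m * κ)) =
        translation 1 ^ m * hbar h ((MulAut.conj ψ) (r' κ)) := by
      rw [map_mul, map_mul, map_zpow, map_zpow, ht, ← hκ]
    have h2 : translation 1 ∈ Subgroup.closure (hbar h '' (Subgroup.map
        (MulAut.conj ψ).toMonoidHom r'.range : Set HomeoPlusLine) ∪ {translation 1}) :=
      Subgroup.subset_closure (Or.inr rfl)
    have h3 : hbar h ((MulAut.conj ψ) (r' κ)) ∈ Subgroup.closure (hbar h '' (Subgroup.map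
        (MulAut.conj ψ).toMonoidHom r'.range : Set HomeoPlusLine) ∪ {translation 1}) :=
      Subgroup.subset_closure (Or.inl ⟨_, ⟨_, ⟨κ, rfl⟩, rfl⟩, rfl⟩)
    have h4 := mul_mem (zpow_mem h2 m) h3
    rw [← h1] at h4
    exact h4
  · rw [Subgroup.closure_le]
    rintro _ (⟨_, ⟨_, ⟨κ, rfl⟩, rfl⟩, rfl⟩ | rfl)
    · exact ⟨_, ⟨(κ : A), rfl⟩, (hκ κ).symm⟩
    · exact ⟨_, ⟨t, rfl⟩, ht⟩

end

/-- The classification of almost minimal and tight actions of `ℤⁿ` on the line. -/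
theorem exists_conj_lineGroup (h : ℝ ≃ₜ Set.Ioo (0 : ℝ) 1) (n : ℕ) :
    ∀ (A : Type) [CommGroup A] [Module.Finite ℤ (Additive A)] (r : A →* HomeoPlusLine) (g : A),
      Function.Injective r → LineAlmostMinimal r → TightAt r g →
      Module.finrank ℤ (Additive A) = n →
      2 ≤ n ∧ ∃ α : ℝ, Irrational α ∧ α ∈ Set.Ioo (0 : ℝ) 1 ∧
        ∃ ψ : HomeoPlusLine, r.range.map (MulAut.conj ψ).toMonoidHom = lineGroup h α n := by
  induction n with
  | zero =>
    intro A _ _ r g hinj hr hg hA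
    rcases hr.dichotomy hinj hg with ⟨t, c, H⟩ | ⟨h2, -⟩
    · have := (H.finrank_pointStabilizer_add_one hinj).2
      omega
    · omega
  | succ n ih =>
    intro A _ _ r g hinj hr hg hA
    rcases hr.dichotomy hinj hg with ⟨t, c, H⟩ | ⟨h2, hconj⟩
    · obtain ⟨e⟩ := exists_orderIso_Ioo one_pos H.lt
      obtain ⟨r', hr'⟩ := exists_restrict_pointStabilizer (h.trans e.toHomeomorph)
      obtain ⟨hfin, hrank⟩ := H.finrank_pointStabilizer_add_one hinj
      obtain ⟨m, κ, rfl⟩ := H.exists_eq_zpow_mul g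
      obtain ⟨hn, α, hα, hα', ψ, hψ⟩ := ih (pointStabilizer r c) r' κ
        (H.restrict_injective hinj hr') (H.restrict_almostMinimal hr hr')
        (H.restrict_tightAt hr' hg) (by omega)
      obtain ⟨n, rfl⟩ := Nat.exists_eq_add_of_le' hn
      obtain ⟨Ψ, hΨ⟩ := H.exists_conj_lineGroup_succ e hr' hψ
      exact ⟨by omega, α, hα, hα', Ψ, hΨ⟩
    · obtain rfl : n = 1 := by omega
      exact ⟨le_rfl, hconj h⟩

/-! ### Lifts of groups of circle homeomorphisms -/

section

theorem translation_apply (a x : ℝ) : translation a x = x + a := rfl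

theorem translation_zpow (a : ℝ) (m : ℤ) : translation a ^ m = translation (m * a) := by
  have h1 : ∀ n : ℕ, translation a ^ n = translation (n * a) := by
    intro n
    induction n with
    | zero => ext x; simp [translation_apply]
    | succ n ih =>
      rw [pow_succ, ih]
      ext x
      change translation _ (translation _ x) = _
      simp only [translation_apply]
      push_cast; ring
  obtain ⟨n, rfl | rfl⟩ := m.eq_nat_or_neg
  · rw [zpow_natCast, h1]; simp
  · rw [zpow_neg, zpow_natCast, h1, inv_eq_iff_mul_eq_one]
    ext x
    change translation _ (translation _ x) = x
    simp only [translation_apply]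
    push_cast; ring

/-- `F` is a lift of `f`. -/
def IsLift (f : HomeoPlusCircle) (F : HomeoPlusLine) : Prop :=
  ∀ t : ℝ, f • Circle.exp t = Circle.exp (F t)

namespace IsLift

variable {f g : HomeoPlusCircle} {F E : HomeoPlusLine}

theorem mul (hf : IsLift f F) (hg : IsLift g E) : IsLift (f * g) (F * E) := by
  intro t
  rw [mul_smul, hg, hf]; rfl

theorem one : IsLift 1 1 := fun t => by simp

theorem inv (hf : IsLift f F) : IsLift f⁻¹ F⁻¹ := by
  intro t
  rw [inv_smul_eq_iff, hf]
  change _ = Circle.exp (F (F.symm t))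
  rw [F.apply_symm_apply]

theorem pow (hf : IsLift f F) (n : ℕ) : IsLift (f ^ n) (F ^ n) := by
  induction n with
  | zero => exact one
  | succ n ih => rw [pow_succ, pow_succ]; exact ih.mul hf

theorem exists_lift (f : HomeoPlusCircle) : ∃ F, IsLift f F := f.2

theorem eq_of_isLift (hf : IsLift f F) (hg : IsLift g F) : f = g := by
  apply Subtype.ext
  ext1 z
  obtain ⟨t, rfl⟩ := Circle.exp_surjective z
  exact (hf t).trans (hg t).symm

theorem translation_two_pi : IsLift 1 (translation (2 * Real.pi)) := by
  intro t
  rw [one_smul, translation_apply, Circle.exp_add_two_pi]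

theorem mul_translation (hf : IsLift f F) :
    F * translation (2 * Real.pi) = translation (2 * Real.pi) * F := by
  ext t
  exact lift_add_two_pi f F hf t

theorem apply_add_int (hf : IsLift f F) (m : ℤ) (t : ℝ) :
    F (t + m * (2 * Real.pi)) = F t + m * (2 * Real.pi) := by
  have h := (show Commute F (translation (2 * Real.pi)) from hf.mul_translation).zpow_right m
  rw [translation_zpow] at h
  exact DFunLike.congr_fun (show F * _ = _ * F from h) t

/-- The lifts of the identity are the translations by multiples of `2 π`. -/
theorem exists_eq_zpow (hF : IsLift 1 F) : ∃ m : ℤ, F = translation (2 * Real.pi) ^ m := by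
  have hpi := Real.two_pi_pos
  have hF' : ∀ t, ∃ m : ℤ, F t = t + m * (2 * Real.pi) := by
    intro t
    have := hF t
    rw [one_smul] at this
    exact Circle.exp_eq_exp.1 this.symm
  obtain ⟨m, hm⟩ := hF' 0
  refine ⟨m, ?_⟩
  rw [translation_zpow]
  -- The displacement of a lift of the identity is a multiple of `2π` at each point. Monotonicity
  -- between consecutive multiples of `2π` forces it to be the one at `0`.
  ext t
  rw [translation_apply]
  obtain ⟨l, hl⟩ := hF' t
  have h1 : ⌊t / (2 * Real.pi)⌋ * (2 * Real.pi) ≤ t := by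
    rw [← le_div_iff₀ hpi]; exact Int.floor_le _
  have h2 : t < (⌊t / (2 * Real.pi)⌋ + 1 : ℤ) * (2 * Real.pi) := by
    rw [← div_lt_iff₀ hpi]; push_cast; exact Int.lt_floor_add_one _
  set j := ⌊t / (2 * Real.pi)⌋
  have e1 := F.monotone h1
  have e2 := F.strictMono h2
  have a1 := hF.apply_add_int j 0
  have a2 := hF.apply_add_int (j + 1) 0
  rw [zero_add] at a1 a2
  rw [a1, hm, hl] at e1
  rw [a2, hm, hl] at e2
  push_cast at e2 h2
  have b1 : (m : ℝ) < l + 1 := lt_of_mul_lt_mul_right (by linarith) hpi.le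
  have b2 : (l : ℝ) < m + 1 := lt_of_mul_lt_mul_right (by linarith) hpi.le
  have b1' : m < l + 1 := by exact_mod_cast b1
  have b2' : l < m + 1 := by exact_mod_cast b2
  obtain rfl : l = m := by omega
  exact hl

/-- The displacement `F z - z` is `2π`-periodic, so it is controlled by `F 0`. What matters is that
the two bounds are three periods apart. -/
theorem exists_bound (hf : IsLift f F) : ∃ a : ℤ, ∀ z, z + (a - 1 : ℤ) * (2 * Real.pi) ≤ F z ∧
    F z ≤ z + (a + 2 : ℤ) * (2 * Real.pi) := by
  have hpi := Real.two_pi_pos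
  have hfl : ∀ t : ℝ, ∃ j : ℤ, j * (2 * Real.pi) ≤ t ∧ t < (j + 1 : ℤ) * (2 * Real.pi) := by
    intro t
    refine ⟨⌊t / (2 * Real.pi)⌋, ?_, ?_⟩
    · rw [← le_div_iff₀ hpi]; exact Int.floor_le _
    · rw [← div_lt_iff₀ hpi]; push_cast; exact Int.lt_floor_add_one _
  obtain ⟨a, ha1, ha2⟩ := hfl (F 0)
  refine ⟨a, fun z => ?_⟩
  obtain ⟨j, h1, h2⟩ := hfl z
  have e1 := F.monotone h1
  have e2 := F.strictMono h2
  have a1 := hf.apply_add_int j 0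
  have a2 := hf.apply_add_int (j + 1) 0
  rw [zero_add] at a1 a2
  rw [a1] at e1
  rw [a2] at e2
  push_cast at *
  constructor <;> linarith

/-- Lifts of commuting homeomorphisms commute. -/
theorem mul_comm_of_mul_comm (hf : IsLift f F) (hg : IsLift g E) (hfg : f * g = g * f) :
    F * E = E * F := by
  have hpi := Real.two_pi_pos
  -- The commutator of the lifts lifts the identity, so it is the translation by some `2πm`.
  have h1 : IsLift 1 ((F * E) * (E * F)⁻¹) := by
    have := (hf.mul hg).mul (hg.mul hf).inv
    rwa [hfg, mul_inv_cancel] at this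
  obtain ⟨m, hm⟩ := h1.exists_eq_zpow
  rw [mul_inv_eq_iff_eq_mul] at hm
  have h2 : ∀ x, F (E x) = E (F x) + m * (2 * Real.pi) := by
    intro x
    have := DFunLike.congr_fun hm x
    rw [translation_zpow] at this
    exact this
  have h3 : ∀ (j : ℕ) x, (F ^ j) (E x) = E ((F ^ j) x) + (j * m : ℤ) * (2 * Real.pi) := by
    intro j
    induction j with
    | zero => intro x; simp
    | succ j ih =>
      intro x
      have e1 : ∀ y, (F ^ (j + 1)) y = F ((F ^ j) y) := fun y => by rw [pow_succ']; rfl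
      rw [e1, e1, ih, hf.apply_add_int, h2]
      push_cast; ring
  obtain ⟨a, ha⟩ := hg.exists_bound
  -- `F ^ 4` and `E` commute up to `4m` periods, while the displacement of `E` varies by at most
  -- three. Hence `m = 0`.
  have h4 := h3 4 0
  have b1 := ha 0
  have b2 := ha ((F ^ 4) 0)
  have c1 := (F ^ 4).monotone b1.1
  have c2 := (F ^ 4).monotone b1.2
  rw [(hf.pow 4).apply_add_int] at c1 c2
  push_cast at *
  have d1 : (4 * m : ℝ) < 4 := lt_of_mul_lt_mul_right (a := 2 * Real.pi) (by linarith) hpi.le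
  have d2 : (-4 : ℝ) < 4 * m := lt_of_mul_lt_mul_right (a := 2 * Real.pi) (by linarith) hpi.le
  have d1' : 4 * m < 4 := by exact_mod_cast d1
  have d2' : -4 < 4 * m := by exact_mod_cast d2
  obtain rfl : m = 0 := by omega
  rw [hm, zpow_zero, one_mul]

end IsLift

/-- The pairs of an element of `G` and one of its lifts. -/
def liftGroup (G : Subgroup HomeoPlusCircle) : Subgroup (G × HomeoPlusLine) where
  carrier := {p | IsLift p.1 p.2}
  one_mem' := IsLift.one
  mul_mem' := fun ha hb => IsLift.mul ha hb
  inv_mem' := fun ha => IsLift.inv ha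

end

/-! ### Circle groups with a discrete orbit -/

section

variable {A : Type} [CommGroup A] {r : A →* HomeoPlusLine} {π : A →* HomeoPlusCircle}

theorem exists_eq_zpow_of_map_eq_one (hinj : Function.Injective r)
    (hlift : ∀ a, IsLift (π a) (r a)) {L : A} (hL : r L = translation (2 * Real.pi)) {a : A}
    (ha : π a = 1) : ∃ m : ℤ, a = L ^ m := by
  have h1 := hlift a
  rw [ha] at h1
  obtain ⟨m, hm⟩ := h1.exists_eq_zpow
  exact ⟨m, hinj (by rw [hm, map_zpow, hL])⟩

theorem map_zpow_eq_one (hlift : ∀ a, IsLift (π a) (r a)) {L : A}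
    (hL : r L = translation (2 * Real.pi)) (m : ℤ) : π (L ^ m) = 1 := by
  have h1 := hlift L
  rw [hL] at h1
  rw [map_zpow, h1.eq_of_isLift IsLift.translation_two_pi, one_zpow]

/-- If `G` is almost minimal on the circle, so are its lifts on the line. -/
theorem IsAlmostMinimal.lineAlmostMinimal (hlift : ∀ a, IsLift (π a) (r a)) {L : A}
    (hL : r L = translation (2 * Real.pi)) (hG : IsAlmostMinimal π.range) :
    LineAlmostMinimal r := by
  have hcount : (Circle.exp ⁻¹' {x : Circle | ¬ Dense (MulAction.orbit π.range x)}).Countable := by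
    rw [← Set.biUnion_preimage_singleton]
    refine Set.Countable.biUnion hG fun x _ => ?_
    obtain ⟨t, rfl⟩ := Circle.exp_surjective x
    refine (Set.countable_range fun m : ℤ => t + m * (2 * Real.pi)).mono ?_
    intro s hs
    obtain ⟨m, hm⟩ := Circle.exp_eq_exp.1 (show Circle.exp s = Circle.exp t from hs)
    exact ⟨m, hm.symm⟩
  refine Set.Countable.mono ?_ hcount
  intro t ht hd
  apply ht
  rw [dense_iff_inter_open]
  intro V hV hV'
  obtain ⟨_, ⟨v, hv, rfl⟩, ⟨⟨_, a, rfl⟩, ha⟩⟩ := hd.inter_open_nonempty _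
    (isLocalHomeomorph_circleExp.isOpenMap V hV) (hV'.image _)
  have ha : (π a) • Circle.exp t = Circle.exp v := ha
  rw [hlift] at ha
  obtain ⟨m, hm⟩ := Circle.exp_eq_exp.1 ha
  -- An orbit point over the image of `V` differs from a point of `V` by a multiple of `2π`, which a
  -- power of `L` absorbs.
  refine ⟨v, hv, L ^ (-m) * a, ?_⟩
  simp only
  rw [hom_mul_apply, map_zpow, hL, translation_zpow, translation_apply, hm]
  push_cast; ring

/-- If `G` is tightly transitive on the circle, its lifts are tight at the deck
transformation. -/
theorem IsTightlyTransitive.tightAt (hinj : Function.Injective r)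
    (hlift : ∀ a, IsLift (π a) (r a)) {L : A}
    (hL : r L = translation (2 * Real.pi)) (hG : IsTightlyTransitive π.range) :
    TightAt r L := by
  intro F hLF hF htrans
  refine hG.2 (F.map π) (Subgroup.map_le_range π F) ?_ ⟨?_⟩
  · have hker : π.ker ≤ F := by
      intro a ha
      obtain ⟨m, rfl⟩ := exists_eq_zpow_of_map_eq_one hinj hlift hL ha
      exact zpow_mem hLF m
    rw [MonoidHom.range_eq_map, Subgroup.relIndex_map_map, sup_of_le_left hker, top_sup_eq,
      Subgroup.relIndex_top_right, hF]
  · intro U V hU hU' hV hV'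
    obtain ⟨x, hx⟩ := hU'
    obtain ⟨s, rfl⟩ := Circle.exp_surjective x
    obtain ⟨y, hy⟩ := hV'
    obtain ⟨v, rfl⟩ := Circle.exp_surjective y
    obtain ⟨a, ha, z, hz, hz'⟩ := htrans _ _ (hU.preimage Circle.exp.continuous) ⟨s, hx⟩
      (hV.preimage Circle.exp.continuous) ⟨v, hy⟩
    refine ⟨⟨π a, a, ha, rfl⟩, (π a) • Circle.exp z, ⟨_, hz, rfl⟩, ?_⟩
    rw [hlift]
    exact hz'

theorem spread_eq {k : ℕ} {hk : 1 ≤ k} {φ : ℝ → Circle} {hφ : IsArcParam k φ}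
    {g : HomeoPlusLine} {f : HomeoPlusCircle} {hf : f ∈ homeoKG k φ g} {σ : HomeoPlusLine}
    {τ : HomeoPlusCircle} (h1 : ∀ j ∈ Finset.Icc 1 k, τ • rootPoint k j = rootPoint k j)
    (h2 : ∀ j < k, ∀ t : ℝ, τ • ((f ^ j) • φ t) = (f ^ j) • φ (σ t)) :
    spread hk hφ hf σ = τ :=
  ((existsUnique_spread hk hφ hf σ).choose_spec.2 τ ⟨h1, h2⟩).symm

theorem range_hom_comp {t : A} {c : ℝ} (P : ℝ ≃ₜ Set.Ioo c (r t c)) (a : A) :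
    Set.range (fun s => r a (P s)) = Set.Ioo (r a c) (r (a * t) c) := by
  have h1 : Set.range (fun s => (P s : ℝ)) = Set.Ioo c (r t c) := by
    change Set.range (Subtype.val ∘ P) = _
    rw [Set.range_comp, P.range_coe, Set.image_univ, Subtype.range_coe]
  have h2 : (fun s => r a (P s)) = r a ∘ fun s => (P s : ℝ) := rfl
  rw [h2, Set.range_comp, h1, OrderIso.image_Ioo, hom_mul_apply]

/-- A homeomorphism of the line that conjugates the lifts of a circle group with a discrete orbit
`c, t c, …, t ^ k c = c + 2 π` to lifts with the discrete orbit `(2 π / k) ℤ`. -/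
theorem IsDiscreteOrbit.exists_equivariant {t : A} {c : ℝ} (H : IsDiscreteOrbit r t c) {L : A}
    (hL : r L = translation (2 * Real.pi)) {k : ℕ} (hk : 1 ≤ k) {κ₀ : pointStabilizer r c}
    (hLk : L = t ^ (k : ℤ) * κ₀)
    (θ : ℝ ≃o Set.Ioo (2 * Real.pi * 1 / k) (2 * Real.pi * 2 / k))
    (e : Set.Ioo (2 * Real.pi * 1 / k) (2 * Real.pi * 2 / k) ≃o Set.Ioo c (r t c))
    (ψ : HomeoPlusLine) :
    ∃ Ψ : HomeoPlusLine, (∀ j : ℤ, Ψ ((r t ^ j) c) = 2 * Real.pi / k * (j + 1)) ∧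
      (∀ s, Ψ (e (θ s)) = θ (ψ s)) ∧ ∀ x, Ψ (x + 2 * Real.pi) = Ψ x + 2 * Real.pi := by
  have hpi := Real.two_pi_pos
  have hk0 : (0 : ℝ) < k := by exact_mod_cast hk
  have hkz : (k : ℤ) ≠ 0 := by exact_mod_cast hk0.ne'
  set u : ℝ := 2 * Real.pi / k with hu
  have hu0 : 0 < u := by positivity
  have huk : u * k = 2 * Real.pi := by rw [hu]; field_simp
  let P : ℝ ≃ₜ Set.Ioo c (r t c) := (θ.trans e).toHomeomorph
  have hP : ∀ s, P s = e (θ s) := fun s => rfl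
  -- The powers `t ^ j` alone need not yield a periodic gluing, since `t ^ k` differs from `L` by
  -- `κ₀`. The correction by floor division gives `L * w j = w (j + k)` and leaves the orbit of `c`
  -- unchanged.
  let w : ℤ → A := fun j => t ^ j * (κ₀ : A) ^ (j / (k : ℤ))
  have hw0 : w 0 = 1 := by simp [w]
  have hwk : ∀ j, L * w j = w (j + k) := by
    intro j
    have h1 : (j + k) / (k : ℤ) = j / k + 1 := by
      rw [Int.add_ediv_of_dvd_right dvd_rfl, Int.ediv_self hkz]
    simp only [w]
    rw [h1, hLk, zpow_add, zpow_add, zpow_one]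
    exact mul_mul_mul_comm _ _ _ _ |>.trans (by rw [mul_comm (κ₀ : A), mul_comm (t ^ (k : ℤ))])
  have hκc : ∀ m : ℤ, r ((κ₀ : A) ^ m) c = c := fun m =>
    (pointStabilizer r c).zpow_mem κ₀.2 m
  have hwc : ∀ j, r (w j) c = (r t ^ j) c := by
    intro j
    rw [hom_mul_apply, hκc, map_zpow]
  have hwtc : ∀ j, r (w j * t) c = (r t ^ (j + 1)) c := by
    intro j
    rw [mul_comm, hom_mul_apply, hwc, zpow_succ_apply]
  have hPr : ∀ j, Set.range (fun s => r (w j) (P s)) =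
      Set.Ioo ((r t ^ j) c) ((r t ^ (j + 1)) c) := by
    intro j
    rw [range_hom_comp, hwc, hwtc]
  have hQr : ∀ j : ℤ, Set.range (fun s => (θ (ψ s) : ℝ) + u * j) =
      Set.Ioo (u * (j + 1)) (u * ((j + 1 : ℤ) + 1)) := by
    intro j
    have h1 : (fun s => (θ (ψ s) : ℝ) + u * j) = (fun x => x + u * j) ∘ Subtype.val ∘ θ ∘ ψ := rfl
    rw [h1, Set.range_comp, Set.range_comp, (θ.surjective.comp ψ.surjective).range_eq,
      Set.image_univ, Subtype.range_coe, Set.image_add_const_Ioo]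
    push_cast
    congr 1 <;> rw [hu] <;> ring
  -- The shift `j + 1` makes the base interval `(c, t c)` correspond to the arc `(x_1, x_2)`.
  obtain ⟨Ψ, hΨ1, hΨ2⟩ := exists_glue_subdivision (fun j => (r t ^ j) c)
    (fun j => u * ((j : ℝ) + 1)) (strictMono_zpow_apply H.lt)
    (fun i j hij => by
      have : (i : ℝ) < j := by exact_mod_cast hij
      simp only
      gcongr)
    (exists_zpow_le_lt H.ne H.lt)
    (fun x => by
      have h1 : (⌊x / u⌋ : ℝ) ≤ x / u := Int.floor_le _
      have h2 : x / u < ⌊x / u⌋ + 1 := Int.lt_floor_add_one _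
      rw [le_div_iff₀ hu0] at h1
      rw [div_lt_iff₀ hu0] at h2
      refine ⟨⌊x / u⌋ - 1, ?_, ?_⟩ <;> push_cast <;> linarith)
    (fun j s => r (w j) (P s)) (fun j s => (θ (ψ s) : ℝ) + u * j)
    (fun j s s' => by
      simp only [(r (w j)).lt_iff_lt, hP, Subtype.coe_lt_coe, e.lt_iff_lt, add_lt_add_iff_right,
        θ.lt_iff_lt, ψ.lt_iff_lt])
    hPr hQr
  refine ⟨Ψ, hΨ1, fun s => ?_, fun x => ?_⟩
  · have := hΨ2 0 s
    rw [hw0, map_one, hP] at this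
    simpa using this
  · have hx : x + 2 * Real.pi = r L x := by rw [hL, translation_apply]
    rw [hx]
    obtain ⟨j, h1, h2⟩ := exists_zpow_le_lt H.ne H.lt x
    rcases eq_or_lt_of_le h1 with h | h
    · rw [← h, ← hwc, ← hom_mul_apply, hwk, hwc, hwc, hΨ1, hΨ1, ← huk]
      push_cast; ring
    · have hx' : x ∈ Set.range (fun s => r (w j) (P s)) := by rw [hPr]; exact ⟨h, h2⟩
      obtain ⟨s, rfl⟩ := hx'
      simp only
      rw [← hom_mul_apply, hwk, hΨ2, hΨ2]
      push_cast
      linear_combination huk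

/-- The equivariant `Ψ` descends to the conjugating homeomorphism. Then `t` becomes `f`, the
relation `t ^ k = L * κ₀⁻¹` identifies `g`, and elements of the stabilizer become the maps `σ̄`
because they commute with `t`. -/
theorem IsDiscreteOrbit.areTopConjugate_circleGroup {t : A} {c : ℝ} (H : IsDiscreteOrbit r t c)
    (hlift : ∀ a, IsLift (π a) (r a)) {L : A}
    (hL : r L = translation (2 * Real.pi)) {k : ℕ} (hk : 1 ≤ k) {κ₀ : pointStabilizer r c}
    (hLk : L = t ^ (k : ℤ) * κ₀) {φ : ℝ → Circle} (hφ : IsArcParam k φ)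
    {θ : ℝ ≃o Set.Ioo (2 * Real.pi * 1 / k) (2 * Real.pi * 2 / k)}
    (hθ : ∀ s, φ s = Circle.exp (θ s))
    {e : Set.Ioo (2 * Real.pi * 1 / k) (2 * Real.pi * 2 / k) ≃o Set.Ioo c (r t c)}
    {r' : pointStabilizer r c →* HomeoPlusLine}
    (hr' : ∀ κ x, (e (θ (r' κ x)) : ℝ) = r κ (e (θ x))) {ψ : HomeoPlusLine}
    {B : Subgroup HomeoPlusLine} (hψ : r'.range.map (MulAut.conj ψ).toMonoidHom = B) :
    ∃ (f : HomeoPlusCircle) (hf : f ∈ homeoKG k φ (MulAut.conj ψ (r' κ₀⁻¹))),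
      AreTopConjugate π.range (circleGroup B hk hφ hf) := by
  obtain ⟨Ψ, hΨ1, hΨ2, hΨ3⟩ := H.exists_equivariant hL hk hLk θ e ψ
  obtain ⟨ρ, hρ⟩ := exists_descend Ψ hΨ3
  have hconj : ∀ a x, (MulAut.conj ρ (π a)) • Circle.exp (Ψ x) = Circle.exp (Ψ (r a x)) := by
    intro a x
    rw [← hρ, ← hρ, ← hlift, MulAut.conj_apply, mul_smul, mul_smul, inv_smul_smul]
  have hroot : ∀ j : ℕ, rootPoint k j = Circle.exp (Ψ ((r t ^ ((j : ℤ) - 1)) c)) := by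
    intro j
    rw [hΨ1, rootPoint]
    congr 1
    push_cast; ring
  have hφΨ : ∀ s, φ (ψ s) = Circle.exp (Ψ (e (θ s))) := by
    intro s
    rw [hθ, hΨ2]
  have hσ : ∀ σ s, (MulAut.conj ψ σ) (ψ s) = ψ (σ s) := by
    intro σ s
    change ψ (σ (ψ.symm (ψ s))) = _
    rw [ψ.symm_apply_apply]
  have hf : MulAut.conj ρ (π t) ∈ homeoKG k φ (MulAut.conj ψ (r' κ₀⁻¹)) := by
    constructor
    · intro j _
      rw [hroot, hroot, hconj, ← zpow_succ_apply]
      push_cast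
      ring_nf
    · intro s
      obtain ⟨s, rfl⟩ := ψ.surjective s
      rw [← map_pow, ← map_pow, hφΨ, hconj, hσ, hφΨ, hr']
      have h1 : t ^ k = L * (κ₀⁻¹ : pointStabilizer r c) := by
        rw [hLk, zpow_natCast, Subgroup.coe_inv, mul_inv_cancel_right]
      rw [h1, hom_mul_apply, hL, translation_apply, hΨ3, Circle.exp_add_two_pi]
  have hspread : ∀ κ : pointStabilizer r c,
      spread hk hφ hf (MulAut.conj ψ (r' κ)) = MulAut.conj ρ (π κ) := by
    intro κ
    refine spread_eq (fun j _ => ?_) (fun j _ s => ?_)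
    · rw [hroot, hconj, ← map_zpow, hom_apply_comm, pointStabilizer_apply]
    · obtain ⟨s, rfl⟩ := ψ.surjective s
      rw [← map_pow, ← map_pow, hφΨ, hconj, hconj, hσ, hφΨ, hconj, hr', hom_apply_comm]
  refine ⟨_, hf, ρ, ?_⟩
  rw [circleGroup, ← hψ]
  apply le_antisymm
  · rintro _ ⟨_, ⟨a, rfl⟩, rfl⟩
    obtain ⟨m, κ, rfl⟩ := H.exists_eq_zpow_mul a
    have h1 : (MulAut.conj ρ) (π (t ^ m * κ)) =
        MulAut.conj ρ (π t) ^ m * spread hk hφ hf (MulAut.conj ψ (r' κ)) := by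
      rw [map_mul, map_mul, map_zpow, map_zpow, hspread]
    have h2 : MulAut.conj ρ (π t) ∈ Subgroup.closure (spread hk hφ hf '' (Subgroup.map
        (MulAut.conj ψ).toMonoidHom r'.range : Set HomeoPlusLine) ∪ {MulAut.conj ρ (π t)}) :=
      Subgroup.subset_closure (Or.inr rfl)
    have h3 : spread hk hφ hf (MulAut.conj ψ (r' κ)) ∈ Subgroup.closure
        (spread hk hφ hf '' (Subgroup.map
        (MulAut.conj ψ).toMonoidHom r'.range : Set HomeoPlusLine) ∪ {MulAut.conj ρ (π t)}) :=
      Subgroup.subset_closure (Or.inl ⟨_, ⟨_, ⟨κ, rfl⟩, rfl⟩, rfl⟩)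
    have h4 := mul_mem (zpow_mem h2 m) h3
    rw [← h1] at h4
    exact h4
  · rw [Subgroup.closure_le]
    rintro _ (⟨_, ⟨_, ⟨κ, rfl⟩, rfl⟩, rfl⟩ | rfl)
    · exact ⟨_, ⟨(κ : A), rfl⟩, (hspread κ).symm⟩
    · exact ⟨_, ⟨t, rfl⟩, rfl⟩

end

/-- The pairs of an element of a commutative group of circle homeomorphisms and one of its lifts
form a commutative group. -/
theorem liftGroup_mul_comm {G : Subgroup HomeoPlusCircle} (hG : ∀ a b : G, a * b = b * a)
    (x y : liftGroup G) : x * y = y * x := by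
  apply Subtype.ext
  refine Prod.ext (hG _ _) ?_
  exact IsLift.mul_comm_of_mul_comm x.2 y.2 (congrArg Subtype.val (hG x.1.1 y.1.1))

/-- The lifts of a group of circle homeomorphisms isomorphic to `ℤⁿ` form a group isomorphic to
`ℤⁿ⁺¹`. -/
theorem exists_lift_hom (n : ℕ) (G : Subgroup HomeoPlusCircle)
    (e : G ≃* Multiplicative (Fin n → ℤ)) :
    ∃ (A : Type) (_ : CommGroup A) (r : A →* HomeoPlusLine) (π : A →* HomeoPlusCircle) (L : A),
      Function.Injective r ∧ π.range = G ∧ (∀ a, IsLift (π a) (r a)) ∧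
      r L = translation (2 * Real.pi) ∧ Module.Finite ℤ (Additive A) ∧
      Module.finrank ℤ (Additive A) = n + 1 := by
  have hcomm : ∀ a b : G, a * b = b * a := fun a b => e.injective (by
    rw [map_mul, map_mul, mul_comm])
  let _ : CommGroup (liftGroup G) :=
    { (inferInstance : Group (liftGroup G)) with mul_comm := liftGroup_mul_comm hcomm }
  let r : liftGroup G →* HomeoPlusLine := (MonoidHom.snd G HomeoPlusLine).comp (liftGroup G).subtype
  let q : liftGroup G →* G := (MonoidHom.fst G HomeoPlusLine).comp (liftGroup G).subtype
  let π : liftGroup G →* HomeoPlusCircle := G.subtype.comp q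
  have hlift : ∀ a, IsLift (π a) (r a) := fun a => a.2
  let L : liftGroup G := ⟨(1, translation (2 * Real.pi)), IsLift.translation_two_pi⟩
  have hL : r L = translation (2 * Real.pi) := rfl
  have hinj : Function.Injective r := by
    intro a b hab
    apply Subtype.ext
    refine Prod.ext (Subtype.ext ?_) hab
    exact (hlift a).eq_of_isLift (hab ▸ hlift b)
  have hq : Function.Surjective q := by
    intro g
    obtain ⟨F, hF⟩ := IsLift.exists_lift (g : HomeoPlusCircle)
    exact ⟨⟨(g, F), hF⟩, rfl⟩
  have hrange : π.range = G := by
    rw [MonoidHom.range_comp, MonoidHom.range_eq_top.2 hq, ← MonoidHom.range_eq_map,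
      Subgroup.range_subtype]
  let p : Additive (liftGroup G) →ₗ[ℤ] (Fin n → ℤ) :=
    (MonoidHom.toAdditiveLeft (e.toMonoidHom.comp q)).toIntLinearMap
  have hp : ∀ a, p a = (e (q a.toMul)).toAdd := fun a => rfl
  have hps : Function.Surjective p := fun v => by
    obtain ⟨a, ha⟩ := hq (e.symm (Multiplicative.ofAdd v))
    refine ⟨Additive.ofMul a, ?_⟩
    rw [hp, toMul_ofMul, ha, e.apply_symm_apply, toAdd_ofAdd]
  -- As `ℤⁿ` is projective, the projection to `G` splits, and its kernel is the infinite cyclic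
  -- group of powers of `L`.
  obtain ⟨s, hs⟩ := Module.projective_lifting_property p LinearMap.id hps
  have hs' : ∀ v, p (s v) = v := fun v => LinearMap.congr_fun hs v
  have hker : ∀ a : Additive (liftGroup G), p a = 0 → π a.toMul = 1 := by
    intro a ha
    rw [hp] at ha
    have h1 : e (q a.toMul) = e 1 := by rw [map_one]; exact ha
    exact congrArg Subtype.val (e.injective h1)
  have hpL : ∀ m : ℤ, p (Additive.ofMul (L ^ m)) = 0 := by
    intro m
    have h1 : q (L ^ m) = 1 := Subtype.ext (map_zpow_eq_one hlift hL m)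
    rw [hp, toMul_ofMul, h1, map_one, toAdd_one]
  obtain ⟨h1, h2⟩ := finite_and_finrank_of_split s.toAddMonoidHom
    (fun v w hvw => by rw [← hs' v, ← hs' w]; exact congrArg p hvw) L
    (fun a => by
      have h3 := hker (Additive.ofMul a - s (p (Additive.ofMul a)))
        (by rw [map_sub, hs', sub_self])
      obtain ⟨m, hm⟩ := exists_eq_zpow_of_map_eq_one hinj hlift hL h3
      exact ⟨m, p (Additive.ofMul a), eq_mul_of_div_eq hm⟩)
    (fun m v h3 => by
      have h4 : v = 0 := by
        rw [← hs' v, ← hpL m, h3]; rfl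
      rw [h4, map_zero, toMul_zero] at h3
      have h5 := congrArg r h3
      rw [map_zpow, hL, translation_zpow, map_one] at h5
      have h6 := DFunLike.congr_fun h5 0
      rw [translation_apply, zero_add] at h6
      have h7 : (m : ℝ) = 0 := by
        rcases mul_eq_zero.1 (show (m : ℝ) * (2 * Real.pi) = 0 from h6) with h | h
        · exact h
        · exact absurd h Real.two_pi_pos.ne'
      exact_mod_cast h7)
  refine ⟨liftGroup G, inferInstance, r, π, L, hinj, hrange, hlift, hL, h1, ?_⟩
  rw [h2]
  simp

end TightCircle

/-! ### The classification on the circle -/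

open TightCircle in
theorem theorem5p3
    (h : ℝ ≃ₜ Set.Ioo (0 : ℝ) 1)
    (φ : ℕ → ℝ → Circle)
    (hφ : ∀ k : ℕ, 1 ≤ k → TightCircle.IsArcParam k (φ k))
    (n : ℕ) (hn : 2 ≤ n)
    (G : Subgroup TightCircle.HomeoPlusCircle)
    (hG : Nonempty (G ≃* Multiplicative (Fin n → ℤ)))
    (hGt : TightCircle.IsTightlyTransitive G)
    (hGm : TightCircle.IsAlmostMinimal G) :
    ∃ α : ℝ, Irrational α ∧ α ∈ Set.Ioo (0 : ℝ) 1 ∧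
    ∃ (k : ℕ) (hk : 1 ≤ k),
    ∃ g ∈ TightCircle.lineGroup h α n,
      (∀ s : ℕ, 1 ≤ s → Nat.gcd k s ≠ 1 →
        ¬ ∃ w ∈ TightCircle.lineGroup h α n, w ^ s = g) ∧
    ∃ (f : TightCircle.HomeoPlusCircle) (hf : f ∈ TightCircle.homeoKG k (φ k) g),
      TightCircle.AreTopConjugate G
        (TightCircle.circleGroup (TightCircle.lineGroup h α n) hk (hφ k hk) hf) := by
  obtain ⟨E⟩ := hG
  have hpi := Real.two_pi_pos
  obtain ⟨A, _, r, π, L, hinj, hrange, hlift, hL, hfin, hrank⟩ := exists_lift_hom n G E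
  have htf : ∀ a : A, ∀ d : ℕ, d ≠ 0 → π a ^ d = 1 → π a = 1 := by
    intro a d hd ha
    have hmem : π a ∈ G := hrange ▸ ⟨a, rfl⟩
    have h1 : (⟨π a, hmem⟩ : G) ^ d = 1 := Subtype.ext ha
    have h2 : (E ⟨π a, hmem⟩) ^ d = 1 := by rw [← map_pow, h1, map_one]
    have h3 : E ⟨π a, hmem⟩ = 1 := by
      have h4 : d • (E ⟨π a, hmem⟩).toAdd = 0 := h2
      rcases smul_eq_zero.1 h4 with h5 | h5
      · exact absurd h5 hd
      · exact h5
    have h4 : (⟨π a, hmem⟩ : G) = 1 := E.injective (by rw [h3, map_one])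
    exact congrArg Subtype.val h4
  subst hrange
  have hr := hGm.lineAlmostMinimal hlift hL
  have ht := hGt.tightAt hinj hlift hL
  rcases hr.dichotomy hinj ht with ⟨t, c, H⟩ | ⟨h2, -⟩
  swap
  -- In the free case the lifts would have rank two, but their rank is `n + 1 ≥ 3`.
  · omega
  obtain ⟨m, κ₀, hm⟩ := H.exists_eq_zpow_mul L
  -- `L` moves `c` to `t ^ m c = c + 2π`, to the right of `c`.
  have hm0 : 0 < m := by
    have h1 : r L c = (r t ^ m) c := by
      rw [hm, hom_mul_apply, pointStabilizer_apply, map_zpow]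
    rw [← (strictMono_zpow_apply H.lt).lt_iff_lt, ← h1, hL, translation_apply, zpow_zero]
    change c < _
    linarith
  obtain ⟨k, rfl⟩ := Int.eq_ofNat_of_zero_le hm0.le
  have hk : 1 ≤ k := by omega
  have hk0 : (0 : ℝ) < k := by exact_mod_cast hk
  obtain ⟨θ, hθ⟩ := hφ k hk
  obtain ⟨e⟩ := exists_orderIso_Ioo
    (show 2 * Real.pi * 1 / k < 2 * Real.pi * 2 / k by gcongr; norm_num) H.lt
  obtain ⟨r', hr'⟩ := exists_restrict_pointStabilizer (θ.trans e).toHomeomorph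
  have hr'inj := H.restrict_injective hinj hr'
  obtain ⟨hfin', hrank'⟩ := H.finrank_pointStabilizer_add_one hinj
  obtain ⟨-, α, hα, hα', ψ, hψ⟩ := exists_conj_lineGroup h n (pointStabilizer r c) r' κ₀
    hr'inj (H.restrict_almostMinimal hr hr') (H.restrict_tightAt hr' (hm ▸ ht)) (by omega)
  refine ⟨α, hα, hα', k, hk, MulAut.conj ψ (r' κ₀⁻¹), ?_, ?_,
    H.areTopConjugate_circleGroup hlift hL hk hm (hφ k hk) hθ hr' hψ⟩
  · rw [← hψ]
    exact ⟨_, ⟨_, rfl⟩, rfl⟩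
  · rintro s hs hgcd ⟨w, hw, hws⟩
    rw [← hψ] at hw
    obtain ⟨_, ⟨κ, rfl⟩, rfl⟩ := hw
    have h1 : κ ^ s = κ₀⁻¹ := by
      apply hr'inj
      apply (MulAut.conj ψ).injective
      rw [map_pow, map_pow]
      exact hws
    obtain ⟨k', hk'⟩ := Nat.gcd_dvd_left k s
    obtain ⟨s', hs'⟩ := Nat.gcd_dvd_right k s
    have hd0 : Nat.gcd k s ≠ 0 := by
      intro h0
      have := (Nat.gcd_eq_zero_iff.1 h0).1
      omega
    generalize Nat.gcd k s = d at *
    -- With `k = d k'`, `s = d s'` and `κ₀ = κ ^ (-s)`, both factors of `L = t ^ k * κ₀` are `d`-th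
    -- powers. The root maps to a torsion element of `G`, hence to `1`, so it is itself a power `L ^
    -- l`, and `l d = 1` contradicts `d ≠ 1`.
    have h2 : L = (t ^ k' * ((κ : A) ^ s')⁻¹) ^ d := by
      have h3 : (κ₀ : A) = ((κ : A) ^ s)⁻¹ := by
        rw [show (κ : A) ^ s = (κ₀ : A)⁻¹ from congrArg Subtype.val h1, inv_inv]
      rw [hm, h3, zpow_natCast, hk', hs', mul_pow, inv_pow, ← pow_mul, ← pow_mul, mul_comm k',
        mul_comm s']
    have h3 : π (t ^ k' * ((κ : A) ^ s')⁻¹) = 1 := by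
      refine htf _ d hd0 ?_
      rw [← map_pow, ← h2]
      simpa using map_zpow_eq_one hlift hL 1
    obtain ⟨l, hl⟩ := exists_eq_zpow_of_map_eq_one hinj hlift hL h3
    rw [hl, ← zpow_natCast, ← zpow_mul] at h2
    have h4 := congrArg r h2
    rw [map_zpow, hL, translation_zpow] at h4
    have h5 := DFunLike.congr_fun h4 0
    rw [translation_apply, translation_apply, zero_add, zero_add] at h5
    have h6 : (1 : ℝ) = ((l * d : ℤ) : ℝ) := by
      have : (2 * Real.pi) * (1 - ((l * d : ℤ) : ℝ)) = 0 := by linear_combination h5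
      rcases mul_eq_zero.1 this with h | h
      · exact absurd h hpi.ne'
      · linarith
    have h7 : l * (d : ℤ) = 1 := by exact_mod_cast h6.symm
    have h8 := Int.isUnit_iff.1 (IsUnit.of_mul_eq_one_right l h7)
    omega
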